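/- For a finite set $E$ of edges let $\nu(E)$ be the maximum cardinality of a matching contained in $E$. In the adversarial-injections model an adversary picks a simple graph $G=(V,E)$ with $V=\{0,\dots,n-1\}$, a partition $E=E_{\mathrm{good}}\cup E_{\mathrm{noise}}$ into two disjoint sets, and an order of arrival of the edges. Then the edges of $E_{\mathrm{good}}$ are permuted uniformly at random among the positions that they occupy, while the edges of $E_{\mathrm{noise}}$ stay in place. An algorithm that knows $n$, but neither the partition nor the permutation, reads the resulting stream once, edge by edge, and has to output a matching of $G$. It is a semi-streaming algorithm if, on every stream of the edges of a simple graph on $n$ vertices, its total working memory is $O(n\,(\log n)^{c})$ bits for some constant $c$. (Here an algorithm is a fixed deterministic program on a random-access machine with a write-only output.) There are an absolute constant $\gamma>0$ and a semi-streaming algorithm that always outputs a matching $M\subseteq E$ of $G$ and for which, for all $n$ and all choices of the adversary, $$\mathbb{E}\bigl[|M|\bigr]\;\ge\;\Bigl(\tfrac12+\gamma\Bigr)\,\nu(E_{\mathrm{good}}),$$ where the expectation is over the random permutation of $E_{\mathrm{good}}$. -/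

import Mathlib

/-! ### Matchings -/

/-- A set `M` of edges is a matching if every vertex has at most one incident edge in `M`. -/
def IsMatching {V : Type*} [DecidableEq V] (M : Finset (Sym2 V)) : Prop :=
  ∀ v : V, (M.filter (fun e => v ∈ e)).card ≤ 1

open Classical in
/-- The maximum cardinality of a matching contained in the edge set `E`. -/
noncomputable def matchingNumber {V : Type*} [DecidableEq V] (E : Finset (Sym2 V)) : ℕ :=
  (E.powerset.filter (fun M => IsMatching M)).sup Finset.card

/-- The set of (unordered) edges listed by a list of pairs of endpoints. -/
def edgeSetOf {n : ℕ} (l : List (Fin n × Fin n)) : Finset (Sym2 (Fin n)) :=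
  (l.map (fun e => s(e.1, e.2))).toFinset

/-! ### One-pass streaming programs on a random-access memory

A program works on `k` arrays of natural numbers, all of whose cells are initially `0`. Besides,
it can look at the number of vertices and at the two endpoints of the current edge of the stream,
and it can append pairs of numbers to a write-only output. -/

/-- What a program sees of its input: the number of vertices, and the endpoints of the current
edge of the stream. -/
structure StreamInput where
  numVertices : ℕ
  fst : ℕ
  snd : ℕ

/-- Arithmetic expressions over `k` arrays. The comparisons `lt` and `eq` return `1` for true and
`0` for false; `sub` is truncated subtraction; `cell a i` is the content of cell `i` of
array `a`. -/
inductive StreamExpr (k : ℕ) : Type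
  | const (c : ℕ)
  | numVertices
  | fst
  | snd
  | cell (a : Fin k) (i : StreamExpr k)
  | add (x y : StreamExpr k)
  | sub (x y : StreamExpr k)
  | mul (x y : StreamExpr k)
  | div (x y : StreamExpr k)
  | mod (x y : StreamExpr k)
  | lt (x y : StreamExpr k)
  | eq (x y : StreamExpr k)

/-- The value of an expression. -/
def StreamExpr.eval {k : ℕ} (inp : StreamInput) (mem : Fin k → ℕ → ℕ) : StreamExpr k → ℕ
  | .const c => c
  | .numVertices => inp.numVertices
  | .fst => inp.fst
  | .snd => inp.snd
  | .cell a i => mem a (i.eval inp mem)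
  | .add x y => x.eval inp mem + y.eval inp mem
  | .sub x y => x.eval inp mem - y.eval inp mem
  | .mul x y => x.eval inp mem * y.eval inp mem
  | .div x y => x.eval inp mem / y.eval inp mem
  | .mod x y => x.eval inp mem % y.eval inp mem
  | .lt x y => if x.eval inp mem < y.eval inp mem then 1 else 0
  | .eq x y => if x.eval inp mem = y.eval inp mem then 1 else 0

/-- Commands: `write a i x` stores the value of `x` in cell `i` of array `a`, `emit x y` appends
the pair of values of `x` and `y` to the output. Conditions hold when their value is not `0`. -/
inductive StreamCmd (k : ℕ) : Type
  | skip
  | write (a : Fin k) (i x : StreamExpr k)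
  | emit (x y : StreamExpr k)
  | seq (c d : StreamCmd k)
  | ite (b : StreamExpr k) (c d : StreamCmd k)
  | loop (b : StreamExpr k) (c : StreamCmd k)

/-- The memory and the output produced so far. -/
structure StreamState (k : ℕ) where
  mem : Fin k → ℕ → ℕ
  out : List (ℕ × ℕ)

/-- `StreamExec inp S W c s t`: started in state `s`, the command `c` terminates in state `t`, and
all through the execution it only ever writes to the first `S` cells of each array, and only
numbers of at most `W` bits. -/
inductive StreamExec {k : ℕ} (inp : StreamInput) (S W : ℕ) :
    StreamCmd k → StreamState k → StreamState k → Prop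
  | skip (s : StreamState k) : StreamExec inp S W .skip s s
  | write (a : Fin k) (i x : StreamExpr k) (s : StreamState k)
      (hi : i.eval inp s.mem < S) (hx : x.eval inp s.mem < 2 ^ W) :
      StreamExec inp S W (.write a i x) s
        { mem := Function.update s.mem a
            (Function.update (s.mem a) (i.eval inp s.mem) (x.eval inp s.mem))
          out := s.out }
  | emit (x y : StreamExpr k) (s : StreamState k) :
      StreamExec inp S W (.emit x y) s
        { mem := s.mem
          out := s.out ++ [(x.eval inp s.mem, y.eval inp s.mem)] }
  | seq {c d : StreamCmd k} {s t u : StreamState k}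
      (hc : StreamExec inp S W c s t) (hd : StreamExec inp S W d t u) :
      StreamExec inp S W (.seq c d) s u
  | ite_true {b : StreamExpr k} {c d : StreamCmd k} {s t : StreamState k}
      (hb : b.eval inp s.mem ≠ 0) (hc : StreamExec inp S W c s t) :
      StreamExec inp S W (.ite b c d) s t
  | ite_false {b : StreamExpr k} {c d : StreamCmd k} {s t : StreamState k}
      (hb : b.eval inp s.mem = 0) (hd : StreamExec inp S W d s t) :
      StreamExec inp S W (.ite b c d) s t
  | loop_false {b : StreamExpr k} {c : StreamCmd k} {s : StreamState k}
      (hb : b.eval inp s.mem = 0) :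
      StreamExec inp S W (.loop b c) s s
  | loop_true {b : StreamExpr k} {c : StreamCmd k} {s t u : StreamState k}
      (hb : b.eval inp s.mem ≠ 0) (hc : StreamExec inp S W c s t)
      (hl : StreamExec inp S W (.loop b c) t u) :
      StreamExec inp S W (.loop b c) s u

/-- A one-pass streaming program for graphs whose edges arrive one at a time: `init` is executed
before the first edge, `step` once for every edge, `final` after the last edge. -/
structure StreamProgram where
  /-- the number of arrays -/
  k : ℕ
  init : StreamCmd k
  step : StreamCmd k
  final : StreamCmd k

/-- Execution of the command `c` once for each edge of a stream. -/
def StreamPass {k n : ℕ} (S W : ℕ) (c : StreamCmd k) :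
    List (Fin n × Fin n) → StreamState k → StreamState k → Prop
  | [], s, t => s = t
  | e :: σ, s, t => ∃ s', StreamExec ⟨n, e.1, e.2⟩ S W c s s' ∧ StreamPass S W c σ s' t

/-- On the `n`-vertex graph whose edges arrive in the order `σ`, the program terminates with the
output `out`, using only `S` cells of `W` bits in each of its arrays. -/
def StreamProgram.Outputs (P : StreamProgram) (S W : ℕ) {n : ℕ}
    (σ out : List (Fin n × Fin n)) : Prop :=
  ∃ s₁ s₂ s₃ : StreamState P.k,
    StreamExec ⟨n, 0, 0⟩ S W P.init ⟨fun _ _ => 0, []⟩ s₁ ∧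
    StreamPass S W P.step σ s₁ s₂ ∧
    StreamExec ⟨n, 0, 0⟩ S W P.final s₂ s₃ ∧
    s₃.out = out.map (fun e => ((e.1 : ℕ), (e.2 : ℕ)))

/-- A stream of edges of a simple graph: there are no loops, and every edge arrives only once. -/
def IsEdgeStream {n : ℕ} (σ : List (Fin n × Fin n)) : Prop :=
  (∀ e ∈ σ, e.1 ≠ e.2) ∧ (σ.map (fun e => s(e.1, e.2))).Nodup

/-- `P` computes `f` as a semi-streaming algorithm: on every stream of edges of a simple graph
on `n` vertices it outputs the value of `f`, with a memory of `O(n polylog n)` bits. -/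
def StreamProgram.SemiStreaming (P : StreamProgram)
    (f : (n : ℕ) → List (Fin n × Fin n) → List (Fin n × Fin n)) : Prop :=
  ∃ (S W : ℕ → ℕ) (c : ℕ),
    ((fun n : ℕ => (P.k * S n * W n : ℝ)) =O[Filter.atTop]
      (fun n : ℕ => (n : ℝ) * Real.log n ^ c)) ∧
    ∀ (n : ℕ) (σ : List (Fin n × Fin n)), IsEdgeStream σ → P.Outputs (S n) (W n) σ (f n σ)

/-! ### Adversarial injections -/

/-- The choices of the adversary on the vertex set `Fin n`: the edges of a simple graph in an
order of arrival, and which of the positions hold the good edges (the other edges are noise). -/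
structure InjectionInstance (n : ℕ) where
  /-- the number of edges -/
  m : ℕ
  edge : Fin m → Fin n × Fin n
  loopless : ∀ i, (edge i).1 ≠ (edge i).2
  distinct : Function.Injective (fun i => s((edge i).1, (edge i).2))
  good : Finset (Fin m)

/-- The set of all edges of the graph. -/
def InjectionInstance.edges {n : ℕ} (I : InjectionInstance n) : Finset (Sym2 (Fin n)) :=
  Finset.univ.image (fun i => s((I.edge i).1, (I.edge i).2))

/-- The set of good edges. -/
def InjectionInstance.goodEdges {n : ℕ} (I : InjectionInstance n) : Finset (Sym2 (Fin n)) :=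
  I.good.image (fun i => s((I.edge i).1, (I.edge i).2))

/-- The stream that arrives when the good edges are permuted among themselves by `π`. -/
def InjectionInstance.stream {n : ℕ} (I : InjectionInstance n)
    (π : Equiv.Perm {i // i ∈ I.good}) : List (Fin n × Fin n) :=
  List.ofFn (fun i => I.edge (Equiv.Perm.ofSubtype π i))

/-! Let `A` be a maximum matching of good edges and `N` its size. The greedy matching is maximal, so
it has at least `N / 2` edges, and the task is to beat this by a constant factor on average. Fix a
threshold `τ` slightly below `N / 2`, and let `U` be the set of the `2 * τ` vertices covered by the
first `τ` greedy edges. Write `X` for the number of edges of `A` that arrive before greedy has `τ`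
edges, `D` for the number of those that greedy takes, `d ≥ D` for the number of edges of `A` inside
`U`, and `u` for the number of vertices of `U` missed by `A`.

Two deterministic bounds complement each other. By counting covered vertices, `N + d + u ≤ 2 *
|greedy|` (`two_mul_length_greedy_ge`), so greedy itself is good if `d` or `u` is large. If `d`, `u`
and `X` are all small, almost every vertex of `U` has an edge of `A` that leaves `U` and arrives
late. Greedy edges can then be augmented, each being replaced by two edges that leave `U`. It is
enough to keep the leaving edges with degrees capped by 2 inside `U` and by 8 outside: this is only
`O(τ)` edges, yet they contain a constant fraction of `τ` disjoint augmentations, up to a loss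
linear in `d`, `u`, `X` (`exists_matching_run`).

Randomness is used only to compare `X` with `D`. While greedy has fewer than `τ` edges, at least `N
+ 2 - 2 * τ ≥ N / 100` edges of `A` are disjoint from it. Such a fresh edge has not arrived yet, so
exchanging it with the edge of `A` that arrives now does not alter the past. Hence an arriving edge
of `A` is fresh, and is taken, with probability at least `1 / 100`, and `E X ≤ 100 * E D`
(`sum_card_arrivals_le`). In a suitable combination of the two bounds (`stream_bound`) the gain from
`D` pays for the loss from `X` (`expect_bound`).

Since `N` is unknown, the program treats a geometric sequence of `O(log n)` thresholds in parallel.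
At the end it finds a maximum matching among all stored edges by exhaustive search; this takes
exponential time, but only memory is bounded. The rest of the proof is a verification of this
program by loop invariants. -/

section Deterministic

variable {V : Type*} [DecidableEq V]

/-! ### The greedy matching -/

/-- The vertices incident to the edges of a list. -/
def coveredVertices (M : List (V × V)) : Finset V :=
  (M.map Prod.fst ++ M.map Prod.snd).toFinset

theorem mem_coveredVertices {M : List (V × V)} {v : V} :
    v ∈ coveredVertices M ↔ ∃ p ∈ M, p.1 = v ∨ p.2 = v := by
  simp only [coveredVertices, List.mem_toFinset, List.mem_append, List.mem_map]
  constructor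
  · rintro (⟨p, hp, h⟩ | ⟨p, hp, h⟩)
    · exact ⟨p, hp, Or.inl h⟩
    · exact ⟨p, hp, Or.inr h⟩
  · rintro ⟨p, hp, h | h⟩
    · exact Or.inl ⟨p, hp, h⟩
    · exact Or.inr ⟨p, hp, h⟩

theorem coveredVertices_append (M : List (V × V)) (e : V × V) :
    coveredVertices (M ++ [e]) = insert e.1 (insert e.2 (coveredVertices M)) := by
  ext v
  simp only [mem_coveredVertices, List.mem_append, List.mem_singleton, Finset.mem_insert]
  grind

theorem coveredVertices_mono {M N : List (V × V)} (h : ∀ p ∈ M, p ∈ N) :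
    coveredVertices M ⊆ coveredVertices N := by
  intro v hv
  rw [mem_coveredVertices] at hv ⊢
  obtain ⟨p, hp, hv⟩ := hv
  exact ⟨p, h p hp, hv⟩

/-- One step of the greedy algorithm: keep an edge if it meets none of the edges kept before. -/
def greedyStep (M : List (V × V)) (e : V × V) : List (V × V) :=
  if e.1 ∈ coveredVertices M ∨ e.2 ∈ coveredVertices M then M else M ++ [e]

/-- The greedy matching of a stream, in order of arrival. -/
def greedy (σ : List (V × V)) : List (V × V) := σ.foldl greedyStep []

theorem greedy_snoc (σ : List (V × V)) (e : V × V) :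
    greedy (σ ++ [e]) = greedyStep (greedy σ) e := by
  simp [greedy]

theorem prefix_greedyStep (M : List (V × V)) (e : V × V) : M <+: greedyStep M e := by
  unfold greedyStep
  split_ifs <;> simp

theorem greedy_prefix (σ ρ : List (V × V)) : greedy σ <+: greedy (σ ++ ρ) := by
  induction ρ using List.reverseRecOn with
  | nil => simp
  | append_singleton ρ e ih =>
    rw [← List.append_assoc, greedy_snoc]
    exact ih.trans (prefix_greedyStep _ _)

theorem mem_of_mem_greedy {σ : List (V × V)} {e : V × V} (h : e ∈ greedy σ) : e ∈ σ := by
  induction σ using List.reverseRecOn with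
  | nil => simp [greedy] at h
  | append_singleton σ a ih =>
    rw [greedy_snoc, greedyStep] at h
    grind

/-- This is maximality. The random-order argument uses the contrapositive: an edge that is disjoint
from the current greedy matching has not arrived yet. -/
theorem greedy_covers {σ : List (V × V)} {e : V × V} (h : e ∈ σ) :
    e.1 ∈ coveredVertices (greedy σ) ∨ e.2 ∈ coveredVertices (greedy σ) := by
  induction σ using List.reverseRecOn with
  | nil => simp at h
  | append_singleton σ a ih =>
    have hmono := coveredVertices_mono (prefix_greedyStep (greedy σ) a).subset
    rw [greedy_snoc]
    rcases List.mem_append.1 h with h | h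
    · exact (ih h).imp (fun h => hmono h) (fun h => hmono h)
    · rw [List.mem_singleton] at h
      subst h
      unfold greedyStep
      split_ifs with hc
      · exact hc
      · simp [coveredVertices_append]

theorem card_coveredVertices_greedy {σ : List (V × V)} (hσ : ∀ e ∈ σ, e.1 ≠ e.2) :
    (coveredVertices (greedy σ)).card = 2 * (greedy σ).length := by
  induction σ using List.reverseRecOn with
  | nil => simp [greedy, coveredVertices]
  | append_singleton σ a ih =>
    have ih' := ih fun e he => hσ e (by simp [he])
    rw [greedy_snoc, greedyStep]
    split_ifs with hc
    · exact ih'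
    · push Not at hc
      have ha := hσ a (by simp)
      rw [coveredVertices_append, Finset.card_insert_of_notMem (by simp [ha, hc.1]),
        Finset.card_insert_of_notMem hc.2, ih']
      simp
      ring

/-- No two pairs of `M` share an endpoint. -/
def PairsDisjoint (M : Finset (V × V)) : Prop :=
  ∀ p ∈ M, ∀ q ∈ M, ∀ v, (p.1 = v ∨ p.2 = v) → (q.1 = v ∨ q.2 = v) → p = q

theorem pairsDisjoint_greedy (σ : List (V × V)) : PairsDisjoint (greedy σ).toFinset := by
  induction σ using List.reverseRecOn with
  | nil => simp [greedy, PairsDisjoint]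
  | append_singleton σ a ih =>
    rw [greedy_snoc, greedyStep]
    split_ifs with hc
    · exact ih
    · push Not at hc
      simp only [mem_coveredVertices] at hc
      intro p hp q hq v hpv hqv
      simp only [List.mem_toFinset, List.mem_append, List.mem_singleton] at hp hq
      have := fun (h₁ : p ∈ greedy σ) (h₂ : q ∈ greedy σ) =>
        ih p (List.mem_toFinset.2 h₁) q (List.mem_toFinset.2 h₂) v hpv hqv
      grind

theorem nodup_greedy (σ : List (V × V)) : (greedy σ).Nodup := by
  induction σ using List.reverseRecOn with
  | nil => simp [greedy]
  | append_singleton σ a ih =>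
    rw [greedy_snoc, greedyStep]
    split_ifs with hc
    · exact ih
    · push Not at hc
      simp only [mem_coveredVertices] at hc
      grind [List.nodup_append]

/-! ### Degree-bounded sets of edges leaving a set of vertices -/

/-- The number of edges of `F` that are incident to `v`. -/
def listDegree (F : List (V × V)) (v : V) : ℕ := F.countP fun p => p.1 = v ∨ p.2 = v

/-- The number of edges kept at a vertex: `2` inside `U`, and `8` outside. -/
def degreeCap (U : Finset V) (v : V) : ℕ := if v ∈ U then 2 else 8

theorem listDegree_snoc (F : List (V × V)) (e : V × V) (v : V) :
    listDegree (F ++ [e]) v = listDegree F v + if e.1 = v ∨ e.2 = v then 1 else 0 := by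
  simp [listDegree, List.countP_append, List.countP_singleton]

/-- Keep an edge if `M` has at least `τ` edges, the edge leaves the set `U` covered by the first
`τ` edges of `M`, and the degrees of its endpoints stay bounded. -/
def runStep (τ : ℕ) (M F : List (V × V)) (e : V × V) : List (V × V) :=
  if τ ≤ M.length ∧
      ¬(e.1 ∈ coveredVertices (M.take τ) ↔ e.2 ∈ coveredVertices (M.take τ)) ∧
      listDegree F e.1 < degreeCap (coveredVertices (M.take τ)) e.1 ∧
      listDegree F e.2 < degreeCap (coveredVertices (M.take τ)) e.2
  then F ++ [e] else F

/-- The edges of a stream that are kept for the threshold `τ`. -/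
def run (τ : ℕ) (σ : List (V × V)) : List (V × V) :=
  (σ.foldl (fun s e => (greedyStep s.1 e, runStep τ s.1 s.2 e))
    (([] : List (V × V)), ([] : List (V × V)))).2

theorem run_snoc (τ : ℕ) (σ : List (V × V)) (e : V × V) :
    run τ (σ ++ [e]) = runStep τ (greedy σ) (run τ σ) e := by
  have h : ∀ σ : List (V × V), (σ.foldl (fun s e => (greedyStep s.1 e, runStep τ s.1 s.2 e))
      (([] : List (V × V)), ([] : List (V × V)))).1 = greedy σ := by
    intro σ
    induction σ using List.reverseRecOn with
    | nil => rfl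
    | append_singleton σ a ih => simp [greedy_snoc, ih]
  simp [run, h]

/-- From the moment when greedy has `τ` edges the set `U` is frozen, so all later tests in `runStep`
refer to the same set and the same caps. -/
theorem take_greedyStep {τ : ℕ} {M : List (V × V)} (h : τ ≤ M.length) (e : V × V) :
    (greedyStep M e).take τ = M.take τ := by
  unfold greedyStep
  split_ifs
  · rfl
  · rw [List.take_append_of_le_length h]

theorem length_greedyStep (M : List (V × V)) (e : V × V) :
    M.length ≤ (greedyStep M e).length :=
  (prefix_greedyStep M e).length_le

theorem run_sublist (τ : ℕ) (σ : List (V × V)) : (run τ σ).Sublist σ := by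
  induction σ using List.reverseRecOn with
  | nil => simp [run]
  | append_singleton σ a ih =>
    rw [run_snoc, runStep]
    split_ifs
    · exact ih.append (List.Sublist.refl _)
    · exact ih.trans (List.sublist_append_left _ _)

theorem run_crossing {τ : ℕ} {σ : List (V × V)} {e : V × V} (he : e ∈ run τ σ) :
    τ ≤ (greedy σ).length ∧ ¬(e.1 ∈ coveredVertices ((greedy σ).take τ) ↔
      e.2 ∈ coveredVertices ((greedy σ).take τ)) := by
  induction σ using List.reverseRecOn with
  | nil => simp [run] at he
  | append_singleton σ a ih =>
    have key : ∀ {P : Prop}, (τ ≤ (greedy σ).length → P) → e ∈ run τ (σ ++ [a]) → P := by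
      intro P hP h
      rw [run_snoc, runStep] at h
      split_ifs at h with hc
      · exact hP hc.1
      · exact hP (ih h).1
    have hle : τ ≤ (greedy σ).length := key id he
    rw [greedy_snoc, take_greedyStep hle]
    refine ⟨hle.trans (length_greedyStep _ _), ?_⟩
    rw [run_snoc, runStep] at he
    split_ifs at he with hc
    · rcases List.mem_append.1 he with h | h
      · exact (ih h).2
      · rw [List.mem_singleton] at h
        exact h ▸ hc.2.1
    · exact (ih he).2

theorem run_eq_nil {τ : ℕ} {σ : List (V × V)} (h : (greedy σ).length < τ) : run τ σ = [] := by
  rw [List.eq_nil_iff_forall_not_mem]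
  exact fun e he => absurd (run_crossing he).1 (by omega)

theorem listDegree_run_le (τ : ℕ) {σ : List (V × V)} (v : V) :
    listDegree (run τ σ) v ≤ degreeCap (coveredVertices ((greedy σ).take τ)) v := by
  induction σ using List.reverseRecOn with
  | nil => simp [run, listDegree]
  | append_singleton σ a ih =>
    by_cases hle : τ ≤ (greedy σ).length
    · rw [greedy_snoc, take_greedyStep hle, run_snoc, runStep]
      split_ifs with hc
      · rw [listDegree_snoc]
        split_ifs with h
        · rcases h with h | h <;> subst h
          · exact hc.2.2.1
          · exact hc.2.2.2
        · exact ih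
      · exact ih
    · rw [run_snoc, runStep, if_neg (fun h => hle h.1), run_eq_nil (by omega)]
      simp [listDegree]

theorem listDegree_mono_runStep (τ : ℕ) (M F : List (V × V)) (e : V × V) (v : V) :
    listDegree F v ≤ listDegree (runStep τ M F e) v := by
  unfold runStep
  split_ifs
  · rw [listDegree_snoc]; omega
  · rfl

/-- A leaving edge that arrives after `U` is frozen can be rejected only because an endpoint is full
at that time, and degrees never decrease afterwards. -/
theorem run_maximal {τ : ℕ} {σ ρ : List (V × V)} (hτ : τ ≤ (greedy σ).length) {e : V × V}
    (he : e ∈ ρ)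
    (hx : ¬(e.1 ∈ coveredVertices ((greedy σ).take τ) ↔
      e.2 ∈ coveredVertices ((greedy σ).take τ))) :
    e ∈ run τ (σ ++ ρ) ∨
    degreeCap (coveredVertices ((greedy σ).take τ)) e.1 ≤ listDegree (run τ (σ ++ ρ)) e.1 ∨
    degreeCap (coveredVertices ((greedy σ).take τ)) e.2 ≤ listDegree (run τ (σ ++ ρ)) e.2 := by
  induction ρ using List.reverseRecOn with
  | nil => simp at he
  | append_singleton ρ a ih =>
    have hp := greedy_prefix σ ρ
    have htake : (greedy (σ ++ ρ)).take τ = (greedy σ).take τ := by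
      obtain ⟨t, ht⟩ := hp
      rw [← ht, List.take_append_of_le_length hτ]
    rw [← List.append_assoc, run_snoc]
    have m1 := listDegree_mono_runStep τ (greedy (σ ++ ρ)) (run τ (σ ++ ρ)) a e.1
    have m2 := listDegree_mono_runStep τ (greedy (σ ++ ρ)) (run τ (σ ++ ρ)) a e.2
    rcases List.mem_append.1 he with h | h
    · rcases ih h with h | h | h
      · left
        unfold runStep
        split_ifs <;> simp [h]
      · exact Or.inr (Or.inl (h.trans m1))
      · exact Or.inr (Or.inr (h.trans m2))
    · rw [List.mem_singleton] at h
      subst h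
      by_cases h1 : listDegree (run τ (σ ++ ρ)) e.1 <
          degreeCap (coveredVertices ((greedy σ).take τ)) e.1
      · by_cases h2 : listDegree (run τ (σ ++ ρ)) e.2 <
            degreeCap (coveredVertices ((greedy σ).take τ)) e.2
        · left
          rw [runStep, htake, if_pos ⟨hτ.trans hp.length_le, hx, h1, h2⟩]
          simp
        · exact Or.inr (Or.inr ((not_lt.1 h2).trans m2))
      · exact Or.inr (Or.inl ((not_lt.1 h1).trans m1))

/-- A list of edges that leave `U` has length at most the sum of the degrees in `U`. -/
theorem length_le_sum_listDegree {F : List (V × V)} {U : Finset V}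
    (hF : ∀ e ∈ F, e.1 ∈ U ∨ e.2 ∈ U) : F.length ≤ ∑ v ∈ U, listDegree F v := by
  induction F using List.reverseRecOn with
  | nil => simp
  | append_singleton F a ih =>
    have h1 := ih fun e he => hF e (by simp [he])
    simp only [listDegree_snoc, Finset.sum_add_distrib, List.length_append, List.length_singleton]
    have h2 : 1 ≤ ∑ v ∈ U, if a.1 = v ∨ a.2 = v then 1 else 0 := by
      rcases hF a (by simp) with h | h
      · calc 1 = if a.1 = a.1 ∨ a.2 = a.1 then 1 else 0 := by simp
          _ ≤ _ := Finset.single_le_sum (f := fun v => if a.1 = v ∨ a.2 = v then 1 else 0)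
            (fun _ _ => Nat.zero_le _) h
      · calc 1 = if a.1 = a.2 ∨ a.2 = a.2 then 1 else 0 := by simp
          _ ≤ _ := Finset.single_le_sum (f := fun v => if a.1 = v ∨ a.2 = v then 1 else 0)
            (fun _ _ => Nat.zero_le _) h
    omega

/-- Each kept edge has an endpoint in `U`, where the cap is 2. The bound serves twice: for the
memory, and for the number of full vertices outside `U`. -/
theorem length_run_le (τ : ℕ) (σ : List (V × V)) :
    (run τ σ).length ≤ 2 * (coveredVertices ((greedy σ).take τ)).card := by
  refine (length_le_sum_listDegree (U := coveredVertices ((greedy σ).take τ)) ?_).trans ?_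
  · intro e he
    have := (run_crossing he).2
    tauto
  · rw [mul_comm, ← smul_eq_mul]
    refine Finset.sum_le_card_nsmul _ _ _ fun v hv => ?_
    simpa [degreeCap, hv] using listDegree_run_le τ (σ := σ) v

end Deterministic

section Deterministic

variable {V : Type*} [DecidableEq V]

/-! ### Counting vertices covered by a set of disjoint pairs -/

/-- The pairs of `A` that meet `U`. -/
def pairsMeeting (A : Finset (V × V)) (U : Finset V) : Finset (V × V) :=
  A.filter fun p => p.1 ∈ U ∨ p.2 ∈ U

/-- The pairs of `A` with both endpoints in `U`. -/
def pairsInside (A : Finset (V × V)) (U : Finset V) : Finset (V × V) :=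
  A.filter fun p => p.1 ∈ U ∧ p.2 ∈ U

/-- The endpoints of the pairs of `A`. -/
def endpoints (A : Finset (V × V)) : Finset V := A.image Prod.fst ∪ A.image Prod.snd

theorem mem_endpoints {A : Finset (V × V)} {v : V} :
    v ∈ endpoints A ↔ ∃ p ∈ A, p.1 = v ∨ p.2 = v := by
  simp only [endpoints, Finset.mem_union, Finset.mem_image]
  grind

/-- Inclusion-exclusion for the pairs whose first, respectively second, endpoint lies in `U`.
Disjointness of the pairs makes both endpoint maps injective, and with the absence of loops their
images are disjoint. -/
theorem card_pairsMeeting_add_card_pairsInside {A : Finset (V × V)} (hA : PairsDisjoint A)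
    (hl : ∀ p ∈ A, p.1 ≠ p.2) (U : Finset V) :
    (pairsMeeting A U).card + (pairsInside A U).card = (U ∩ endpoints A).card := by
  have h1 : pairsMeeting A U = A.filter (fun p => p.1 ∈ U) ∪ A.filter (fun p => p.2 ∈ U) := by
    ext p; simp only [pairsMeeting, Finset.mem_filter, Finset.mem_union]; tauto
  have h2 : pairsInside A U = A.filter (fun p => p.1 ∈ U) ∩ A.filter (fun p => p.2 ∈ U) := by
    ext p; simp only [pairsInside, Finset.mem_filter, Finset.mem_inter]; tauto
  have h3 : U ∩ endpoints A = (A.filter (fun p => p.1 ∈ U)).image Prod.fst ∪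
      (A.filter (fun p => p.2 ∈ U)).image Prod.snd := by
    ext v
    simp only [Finset.mem_inter, mem_endpoints, Finset.mem_union, Finset.mem_image,
      Finset.mem_filter]
    grind
  rw [h1, h2, Finset.card_union_add_card_inter, h3, Finset.card_union_of_disjoint,
    Finset.card_image_of_injOn, Finset.card_image_of_injOn]
  · intro p hp q hq h
    simp only [Finset.coe_filter, Set.mem_ofPred_eq] at hp hq
    exact hA p hp.1 q hq.1 q.2 (Or.inr h) (Or.inr rfl)
  · intro p hp q hq h
    simp only [Finset.coe_filter, Set.mem_ofPred_eq] at hp hq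
    exact hA p hp.1 q hq.1 q.1 (Or.inl h) (Or.inl rfl)
  · rw [Finset.disjoint_left]
    intro v hv hv'
    simp only [Finset.mem_image, Finset.mem_filter] at hv hv'
    obtain ⟨p, ⟨hp, -⟩, rfl⟩ := hv
    obtain ⟨q, ⟨hq, -⟩, hqv⟩ := hv'
    have := hA p hp q hq p.1 (Or.inl rfl) (Or.inr hqv)
    subst this
    exact hl p hp hqv.symm

theorem card_pairsMeeting_le {A : Finset (V × V)} (hA : PairsDisjoint A)
    (hl : ∀ p ∈ A, p.1 ≠ p.2) (U : Finset V) : (pairsMeeting A U).card ≤ U.card := by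
  have := card_pairsMeeting_add_card_pairsInside hA hl U
  have := Finset.card_le_card (Finset.inter_subset_left (s₁ := U) (s₂ := endpoints A))
  omega

/-! ### Disjoint augmentations of a matching -/

/-- If every edge `e` in `Q` has two candidate new partners `x e` and `y e`, and every vertex is
a candidate for at most `8` edges, then a sixteenth of the edges have pairwise distinct partners. -/
theorem exists_disjoint_augmentations {ι : Type*} [DecidableEq ι] (Q : Finset ι) (x y : ι → V)
    (hd : ∀ z, (Q.filter fun e => x e = z ∨ y e = z).card ≤ 8) :
    ∃ R ⊆ Q, Q.card ≤ 16 * R.card ∧ ∀ e ∈ R, ∀ e' ∈ R, ∀ z,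
      (x e = z ∨ y e = z) → (x e' = z ∨ y e' = z) → e = e' := by
  classical
  -- Take a largest conflict-free `R`. Every edge of `Q` then has a candidate among the at most `2 *
  -- R.card` candidates of `R`, each of which serves at most 8 edges; hence the factor 16.
  obtain ⟨R, hR, hmax⟩ := Finset.exists_max_image
    (Q.powerset.filter fun R => ∀ e ∈ R, ∀ e' ∈ R, ∀ z,
      (x e = z ∨ y e = z) → (x e' = z ∨ y e' = z) → e = e') Finset.card
    ⟨∅, by simp⟩
  simp only [Finset.mem_filter, Finset.mem_powerset] at hR hmax
  refine ⟨R, hR.1, ?_, hR.2⟩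
  set Z := R.image x ∪ R.image y with hZ
  have hZc : Z.card ≤ 2 * R.card := by
    have := Finset.card_union_le (R.image x) (R.image y)
    have := Finset.card_image_le (s := R) (f := x)
    have := Finset.card_image_le (s := R) (f := y)
    rw [hZ]
    omega
  have hcov : Q ⊆ Z.biUnion fun z => Q.filter fun e => x e = z ∨ y e = z := by
    intro e he
    simp only [Finset.mem_biUnion, Finset.mem_filter]
    by_contra hne
    push Not at hne
    have hx : x e ∉ Z := fun h => (hne _ h he).1 rfl
    have hy : y e ∉ Z := fun h => (hne _ h he).2 rfl
    have hout : ∀ e' ∈ R, x e' ≠ x e ∧ x e' ≠ y e ∧ y e' ≠ x e ∧ y e' ≠ y e := by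
      intro e' he'
      simp only [hZ, Finset.mem_union, Finset.mem_image, not_or, not_exists, not_and] at hx hy
      exact ⟨hx.1 e' he', hy.1 e' he', hx.2 e' he', hy.2 e' he'⟩
    have heR : e ∉ R := fun h => (hout e h).1 rfl
    have := hmax (insert e R) ⟨Finset.insert_subset he hR.1, by
      intro e₁ h₁ e₂ h₂ z hz₁ hz₂
      rcases Finset.mem_insert.1 h₁ with h₁ | h₁ <;> rcases Finset.mem_insert.1 h₂ with h₂ | h₂
      · rw [h₁, h₂]
      · have := hout _ h₂; subst h₁; grind
      · have := hout _ h₁; subst h₂; grind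
      · exact hR.2 e₁ h₁ e₂ h₂ z hz₁ hz₂⟩
    rw [Finset.card_insert_of_notMem heR] at this
    omega
  calc Q.card ≤ _ := Finset.card_le_card hcov
    _ ≤ Z.card * 8 := Finset.card_biUnion_le_card_mul _ _ _ fun z _ => hd z
    _ ≤ _ := by omega

theorem isMatching_iff {M : Finset (Sym2 V)} :
    IsMatching M ↔ ∀ e ∈ M, ∀ e' ∈ M, ∀ v, v ∈ e → v ∈ e' → e = e' := by
  simp only [IsMatching, Finset.card_le_one, Finset.mem_filter]
  grind

/-- Replacing the edges of `R` in the matching `M` by two edges each. -/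
theorem exists_augmented_matching {M R : Finset (V × V)} (hM : PairsDisjoint M)
    (hl : ∀ p ∈ M, p.1 ≠ p.2) (hR : R ⊆ M) (x y : V × V → V)
    (hx : ∀ e ∈ R, x e ∉ endpoints M) (hy : ∀ e ∈ R, y e ∉ endpoints M)
    (hne : ∀ e ∈ R, x e ≠ y e)
    (hd : ∀ e ∈ R, ∀ e' ∈ R, ∀ z, (x e = z ∨ y e = z) → (x e' = z ∨ y e' = z) → e = e') :
    ∃ N : Finset (Sym2 V), IsMatching N ∧ N.card = M.card + R.card ∧
      ∀ e ∈ N, (∃ p ∈ M, e = s(p.1, p.2)) ∨ ∃ p ∈ R, e = s(p.1, x p) ∨ e = s(p.2, y p) := by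
  simp only [mem_endpoints, not_exists, not_and, not_or] at hx hy
  set N₁ := (M \ R).image fun p => s(p.1, p.2)
  set N₂ := R.image fun p => s(p.1, x p)
  set N₃ := R.image fun p => s(p.2, y p)
  have m₁ : ∀ e, e ∈ N₁ ↔ ∃ p, (p ∈ M ∧ p ∉ R) ∧ s(p.1, p.2) = e := by simp [N₁]
  have m₂ : ∀ e, e ∈ N₂ ↔ ∃ p ∈ R, s(p.1, x p) = e := by intro e; simp only [N₂, Finset.mem_image]
  have m₃ : ∀ e, e ∈ N₃ ↔ ∃ p ∈ R, s(p.2, y p) = e := by intro e; simp only [N₃, Finset.mem_image]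
  have d₁₂ : ∀ p q v, p ∈ M → p ∉ R → q ∈ R → v ∈ s(p.1, p.2) → v ∈ s(q.1, x q) → False := by
    intro p q v hp hpR hq h h'
    have := hM p hp q (hR hq) v
    have := hx q hq p hp
    simp only [Sym2.mem_iff] at h h'
    grind
  have d₁₃ : ∀ p q v, p ∈ M → p ∉ R → q ∈ R → v ∈ s(p.1, p.2) → v ∈ s(q.2, y q) → False := by
    intro p q v hp hpR hq h h'
    have := hM p hp q (hR hq) v
    have := hy q hq p hp
    simp only [Sym2.mem_iff] at h h'
    grind
  have d₂₃ : ∀ p q v, p ∈ R → q ∈ R → v ∈ s(p.1, x p) → v ∈ s(q.2, y q) → False := by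
    intro p q v hp hq h h'
    have h1 := hM p (hR hp) q (hR hq) v
    have h2 := hy q hq p (hR hp)
    have h3 := hx p hp q (hR hq)
    have h4 := hd p hp q hq v
    have h5 := hl p (hR hp)
    have h6 := hne p hp
    simp only [Sym2.mem_iff] at h h'
    grind
  have d₁₁ : ∀ p q v, p ∈ M → q ∈ M → v ∈ s(p.1, p.2) → v ∈ s(q.1, q.2) → p = q := by
    intro p q v hp hq h h'
    simp only [Sym2.mem_iff] at h h'
    exact hM p hp q hq v (by grind) (by grind)
  have d₂₂ : ∀ p q v, p ∈ R → q ∈ R → v ∈ s(p.1, x p) → v ∈ s(q.1, x q) → p = q := by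
    intro p q v hp hq h h'
    have h1 := hM p (hR hp) q (hR hq) v
    have h2 := hx q hq p (hR hp)
    have h3 := hx p hp q (hR hq)
    have h4 := hd p hp q hq v
    simp only [Sym2.mem_iff] at h h'
    grind
  have d₃₃ : ∀ p q v, p ∈ R → q ∈ R → v ∈ s(p.2, y p) → v ∈ s(q.2, y q) → p = q := by
    intro p q v hp hq h h'
    have h1 := hM p (hR hp) q (hR hq) v
    have h2 := hy q hq p (hR hp)
    have h3 := hy p hp q (hR hq)
    have h4 := hd p hp q hq v
    simp only [Sym2.mem_iff] at h h'
    grind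
  refine ⟨N₁ ∪ N₂ ∪ N₃, ?_, ?_, ?_⟩
  · rw [isMatching_iff]
    intro e he e' he' v hv hv'
    simp only [Finset.mem_union, m₁, m₂, m₃] at he he'
    rcases he with (⟨p, hp, rfl⟩ | ⟨p, hp, rfl⟩) | ⟨p, hp, rfl⟩ <;>
    rcases he' with (⟨q, hq, rfl⟩ | ⟨q, hq, rfl⟩) | ⟨q, hq, rfl⟩
    · rw [d₁₁ p q v hp.1 hq.1 hv hv']
    · exact (d₁₂ p q v hp.1 hp.2 hq hv hv').elim
    · exact (d₁₃ p q v hp.1 hp.2 hq hv hv').elim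
    · exact (d₁₂ q p v hq.1 hq.2 hp hv' hv).elim
    · rw [d₂₂ p q v hp hq hv hv']
    · exact (d₂₃ p q v hp hq hv hv').elim
    · exact (d₁₃ q p v hq.1 hq.2 hp hv' hv).elim
    · exact (d₂₃ q p v hq hp hv' hv).elim
    · rw [d₃₃ p q v hp hq hv hv']
  · rw [Finset.card_union_of_disjoint, Finset.card_union_of_disjoint,
      Finset.card_image_of_injOn, Finset.card_image_of_injOn, Finset.card_image_of_injOn,
      Finset.card_sdiff_of_subset hR]
    · have := Finset.card_le_card hR
      omega
    · intro p hp q hq h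
      exact d₃₃ p q p.2 hp hq (by simp) (by simp only at h; rw [← h]; simp)
    · intro p hp q hq h
      exact d₂₂ p q p.1 hp hq (by simp) (by simp only at h; rw [← h]; simp)
    · intro p hp q hq h
      simp only [Finset.coe_sdiff, Set.mem_sdiff, Finset.mem_coe] at hp hq
      exact d₁₁ p q p.1 hp.1 hq.1 (by simp) (by simp only at h; rw [← h]; simp)
    · rw [Finset.disjoint_left]
      intro e he he'
      rw [m₁] at he
      rw [m₂] at he'
      obtain ⟨p, hp, rfl⟩ := he
      obtain ⟨q, hq, h⟩ := he'
      exact d₁₂ p q q.1 hp.1 hp.2 hq (by rw [← h]; simp) (by simp)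
    · rw [Finset.disjoint_left]
      intro e he he'
      rw [Finset.mem_union, m₁, m₂] at he
      rw [m₃] at he'
      obtain ⟨q, hq, h⟩ := he'
      rcases he with ⟨p, hp, rfl⟩ | ⟨p, hp, rfl⟩
      · exact d₁₃ p q q.2 hp.1 hp.2 hq (by rw [← h]; simp) (by simp)
      · exact d₂₃ p q q.2 hp hq (by rw [← h]; simp) (by simp)
  · intro e he
    simp only [Finset.mem_union, m₁, m₂, m₃] at he
    rcases he with (⟨p, hp, rfl⟩ | ⟨p, hp, rfl⟩) | ⟨p, hp, rfl⟩
    · exact Or.inl ⟨p, hp.1, rfl⟩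
    · exact Or.inr ⟨p, hp, Or.inl rfl⟩
    · exact Or.inr ⟨p, hp, Or.inr rfl⟩

/-- In a simple graph, a vertex of degree at least two has two different neighbours. -/
theorem exists_two_neighbours {F : List (V × V)} (hF : (F.map fun e => s(e.1, e.2)).Nodup)
    {v : V} (hv : 2 ≤ listDegree F v) :
    ∃ x x' : V, x ≠ x' ∧ s(v, x) ∈ F.map (fun e => s(e.1, e.2)) ∧
      s(v, x') ∈ F.map (fun e => s(e.1, e.2)) := by
  have hnd : F.Nodup := hF.of_map
  have hc : 1 < (F.filter fun p => p.1 = v ∨ p.2 = v).toFinset.card := by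
    rw [List.toFinset_card_of_nodup (hnd.filter _), ← List.countP_eq_length_filter]
    exact hv
  obtain ⟨p, hp, q, hq, hpq⟩ := Finset.one_lt_card.1 hc
  simp only [List.mem_toFinset, List.mem_filter, decide_eq_true_eq] at hp hq
  have ex : ∀ p ∈ F, (p.1 = v ∨ p.2 = v) → ∃ x, s(v, x) = s(p.1, p.2) := by
    rintro p - (h | h)
    · exact ⟨p.2, by rw [h]⟩
    · exact ⟨p.1, by rw [h, Sym2.eq_swap]⟩
  obtain ⟨x, hx⟩ := ex p hp.1 hp.2
  obtain ⟨x', hx'⟩ := ex q hq.1 hq.2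
  refine ⟨x, x', ?_, ?_, ?_⟩
  · rintro rfl
    exact hpq (List.inj_on_of_nodup_map hF hp.1 hq.1 (hx.symm.trans hx'))
  · exact hx ▸ List.mem_map_of_mem hp.1
  · exact hx' ▸ List.mem_map_of_mem hq.1

end Deterministic

/-! ### The two deterministic bounds for a stream split at a threshold -/

section Deterministic

variable {V : Type*} [DecidableEq V]

theorem endpoints_toFinset (M : List (V × V)) : endpoints M.toFinset = coveredVertices M := by
  ext v
  simp [mem_endpoints, mem_coveredVertices]

/-- The sum of the degrees over `S` is at most the number of edges, if none lies inside `S`. -/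
theorem sum_listDegree_le_length {F : List (V × V)} {S : Finset V}
    (hF : ∀ e ∈ F, ¬(e.1 ∈ S ∧ e.2 ∈ S)) : ∑ v ∈ S, listDegree F v ≤ F.length := by
  induction F using List.reverseRecOn with
  | nil => simp [listDegree]
  | append_singleton F a ih =>
    have h1 := ih fun e he => hF e (by simp [he])
    simp only [listDegree_snoc, Finset.sum_add_distrib, List.length_append, List.length_singleton]
    have h2 : (∑ v ∈ S, if a.1 = v ∨ a.2 = v then 1 else 0) ≤ 1 := by
      rw [Finset.sum_boole, Nat.cast_id, Finset.card_le_one]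
      have := hF a (by simp)
      intro u hu v hv
      simp only [Finset.mem_filter] at hu hv
      grind
    omega

/-- The image of a greedy matching is a matching of the same cardinality. -/
theorem exists_matching_greedy {σ : List (V × V)} (hl : ∀ e ∈ σ, e.1 ≠ e.2) :
    ∃ N : Finset (Sym2 V), IsMatching N ∧ N.card = (greedy σ).length ∧
      ∀ e ∈ N, ∃ p ∈ greedy σ, e = s(p.1, p.2) := by
  -- With `R = ∅` nothing is augmented, and the partner functions are dummies.
  obtain ⟨N, h1, h2, h3⟩ := exists_augmented_matching (pairsDisjoint_greedy σ)
    (fun p hp => hl p (mem_of_mem_greedy (List.mem_toFinset.1 hp)))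
    (Finset.empty_subset _) Prod.fst Prod.fst (by simp) (by simp) (by simp) (by simp)
  rw [List.toFinset_card_of_nodup (nodup_greedy σ)] at h2
  exact ⟨N, h1, by simpa using h2, fun e he => by simpa using h3 e he⟩

/-- The edges kept for the threshold `τ`, together with the first `τ` greedy edges, contain a
matching with more than `τ` edges, unless `A` meets the vertices of these greedy edges in an
untypical way. -/
theorem exists_matching_run {σ ρ : List (V × V)} {τ : ℕ}
    (hσ : ((σ ++ ρ).map fun e => s(e.1, e.2)).Nodup) (hl : ∀ e ∈ σ ++ ρ, e.1 ≠ e.2)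
    (hτ : (greedy σ).length = τ)
    {A : Finset (V × V)} (hA : PairsDisjoint A) (hAσ : ∀ e ∈ A, e ∈ σ ++ ρ) :
    ∃ N : Finset (Sym2 V), IsMatching N ∧
      (∀ e ∈ N, ∃ p ∈ greedy σ ++ run τ (σ ++ ρ), e = s(p.1, p.2)) ∧
      33 * τ ≤ 32 * N.card + 2 * (coveredVertices (greedy σ) \ endpoints A).card
        + 4 * (pairsInside A (coveredVertices (greedy σ))).card
        + 2 * (A.filter (· ∈ σ)).card := by
  classical
  set U := coveredVertices (greedy σ) with hU
  set F := run τ (σ ++ ρ) with hF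
  have htake : (greedy (σ ++ ρ)).take τ = greedy σ := by
    obtain ⟨t, ht⟩ := greedy_prefix σ ρ
    rw [← ht, ← hτ, List.take_left]
  have hlσ : ∀ e ∈ σ, e.1 ≠ e.2 := fun e he => hl e (by simp [he])
  have hlA : ∀ e ∈ A, e.1 ≠ e.2 := fun e he => hl e (hAσ e he)
  have hcross : ∀ e ∈ F, ¬(e.1 ∈ U ↔ e.2 ∈ U) := by
    intro e he
    have := (run_crossing he).2
    rwa [htake] at this
  have hdeg : ∀ v, listDegree F v ≤ degreeCap U v := by
    intro v
    have := listDegree_run_le τ (σ := σ ++ ρ) v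
    rwa [htake] at this
  have hmaxl : ∀ e ∈ ρ, ¬(e.1 ∈ U ↔ e.2 ∈ U) →
      e ∈ F ∨ degreeCap U e.1 ≤ listDegree F e.1 ∨ degreeCap U e.2 ≤ listDegree F e.2 := by
    intro e he hx
    have ht : (greedy σ).take τ = greedy σ := by rw [← hτ, List.take_length]
    have := run_maximal (τ := τ) hτ.ge he (by rwa [ht])
    rwa [ht] at this
  have hUc : U.card = 2 * τ := by rw [hU, card_coveredVertices_greedy hlσ, hτ]
  have hFlen : F.length ≤ 4 * τ := by
    have := length_run_le τ (σ ++ ρ)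
    rw [htake, ← hU, hUc, ← hF] at this
    omega
  have hFnd : (F.map fun e => s(e.1, e.2)).Nodup := hσ.sublist ((run_sublist _ _).map _)
  set M := (greedy σ).toFinset with hM
  have hMd : PairsDisjoint M := pairsDisjoint_greedy σ
  have hMl : ∀ p ∈ M, p.1 ≠ p.2 :=
    fun p hp => hlσ p (mem_of_mem_greedy (List.mem_toFinset.1 hp))
  have hMe : endpoints M = U := endpoints_toFinset _
  have hMc : M.card = τ := by rw [hM, List.toFinset_card_of_nodup (nodup_greedy σ), hτ]
  set Sat := (coveredVertices F).filter fun x => x ∉ U ∧ 8 ≤ listDegree F x with hSat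
  -- No kept edge joins two vertices outside `U`, so `8 * Sat.card ≤ F.length ≤ 4 * τ`. The cap 8 is
  -- chosen so that full outer vertices spoil at most half of the `τ` greedy edges.
  have hSatc : 2 * Sat.card ≤ τ := by
    have h1 : Sat.card * 8 ≤ ∑ v ∈ Sat, listDegree F v := by
      rw [← smul_eq_mul]
      exact Finset.card_nsmul_le_sum _ _ _ fun v hv => (Finset.mem_filter.1 hv).2.2
    have h2 : ∑ v ∈ Sat, listDegree F v ≤ F.length := by
      refine sum_listDegree_le_length fun e he h => hcross e he ?_
      have h1 := (Finset.mem_filter.1 h.1).2.1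
      have h2 := (Finset.mem_filter.1 h.2).2.1
      tauto
    omega
  have hSatm : ∀ x, x ∉ U → 8 ≤ listDegree F x → x ∈ Sat := by
    intro x hx h8
    refine Finset.mem_filter.2 ⟨?_, hx, h8⟩
    rw [mem_coveredVertices]
    have : 0 < listDegree F x := by omega
    rw [listDegree, List.countP_pos_iff] at this
    simpa using this
  set Nbr : V → V → Prop := fun v x => s(v, x) ∈ F.map fun e => s(e.1, e.2) with hNbr
  have hNbrU : ∀ v x, v ∈ U → Nbr v x → x ∉ U := by
    intro v x hv h
    simp only [hNbr, List.mem_map] at h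
    obtain ⟨e, he, h⟩ := h
    have := hcross e he
    simp only [Sym2.eq_iff] at h
    grind
  -- The edge of `A` at `v` leaves `U`, arrives late, and its outer end is not full. So if it was
  -- rejected, the reason is that `v` already had two kept edges.
  set Good : V → Prop := fun v => ∃ x, x ∉ U ∧ listDegree F x < 8 ∧
    ∃ f ∈ A, f ∈ ρ ∧ s(f.1, f.2) = s(v, x) with hGood
  have hgood : ∀ v ∈ U, Good v → ∃ x, (∃ f ∈ A, s(f.1, f.2) = s(v, x)) ∧
      (Nbr v x ∨ ∃ z z', z ≠ z' ∧ Nbr v z ∧ Nbr v z') := by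
    rintro v hv ⟨x, hx, hx8, f, hfA, hfρ, hf⟩
    refine ⟨x, ⟨f, hfA, hf⟩, ?_⟩
    have hfx : ¬(f.1 ∈ U ↔ f.2 ∈ U) := by
      simp only [Sym2.eq_iff] at hf
      grind
    have h2 : degreeCap U v = 2 := by simp [degreeCap, hv]
    have h8 : degreeCap U x = 8 := by simp [degreeCap, hx]
    have h3 : f ∈ F ∨ 2 ≤ listDegree F v := by
      have := hmaxl f hfρ hfx
      simp only [Sym2.eq_iff] at hf
      rcases hf with ⟨h, h'⟩ | ⟨h, h'⟩ <;> rw [h, h', h2, h8] at this <;> grind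
    rcases h3 with h3 | h3
    · left
      simp only [hNbr]
      rw [← hf]
      exact List.mem_map_of_mem (f := fun e : V × V => s(e.1, e.2)) h3
    · exact Or.inr (exists_two_neighbours hFnd h3)
  set Bad := U.filter fun v => ¬Good v with hBad
  -- A vertex of `U` is bad for one of four reasons: `A` misses it, its edge of `A` stays inside `U`
  -- (two vertices per edge), that edge arrived early, or its outer end is full. In the last two
  -- cases `ψ` recovers the vertex as the end of the edge in `U`.
  have hBadc : Bad.card ≤ (U \ endpoints A).card + 2 * (pairsInside A U).card
      + (A.filter (· ∈ σ)).card + Sat.card := by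
    set ψ : V × V → V := fun e => if e.1 ∈ U then e.1 else e.2 with hψ
    have hsub : Bad ⊆ (U \ endpoints A) ∪ endpoints (pairsInside A U)
        ∪ (A.filter (· ∈ σ)).image ψ ∪ (pairsMeeting A Sat).image ψ := by
      intro v hv
      obtain ⟨hvU, hvG⟩ := Finset.mem_filter.1 hv
      by_contra hc
      simp only [Finset.mem_union, not_or] at hc
      obtain ⟨⟨⟨c1, c2⟩, c3⟩, c4⟩ := hc
      rw [Finset.mem_sdiff] at c1
      push Not at c1
      obtain ⟨f, hf, hfv⟩ := mem_endpoints.1 (c1 hvU)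
      obtain ⟨x, hx⟩ : ∃ x, s(f.1, f.2) = s(v, x) := by
        rcases hfv with h | h
        · exact ⟨f.2, by rw [h]⟩
        · exact ⟨f.1, by rw [h, Sym2.eq_swap]⟩
      have hxU : x ∉ U := by
        intro hxU
        refine c2 (mem_endpoints.2 ⟨f, ?_, hfv⟩)
        simp only [pairsInside, Finset.mem_filter]
        simp only [Sym2.eq_iff] at hx
        grind
      have hψf : ψ f = v := by
        simp only [hψ]
        simp only [Sym2.eq_iff] at hx
        grind
      refine hvG ⟨x, hxU, ?_, f, hf, ?_, hx⟩
      · by_contra h8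
        refine c4 (Finset.mem_image.2 ⟨f, ?_, hψf⟩)
        have := hSatm x hxU (not_lt.1 h8)
        simp only [pairsMeeting, Finset.mem_filter]
        simp only [Sym2.eq_iff] at hx
        grind
      · rcases List.mem_append.1 (hAσ f hf) with h | h
        · exact (c3 (Finset.mem_image.2 ⟨f, Finset.mem_filter.2 ⟨hf, h⟩, hψf⟩)).elim
        · exact h
    have k1 := Finset.card_le_card hsub
    have k2 := Finset.card_union_le ((U \ endpoints A) ∪ endpoints (pairsInside A U)
        ∪ (A.filter (· ∈ σ)).image ψ) ((pairsMeeting A Sat).image ψ)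
    have k3 := Finset.card_union_le ((U \ endpoints A) ∪ endpoints (pairsInside A U))
        ((A.filter (· ∈ σ)).image ψ)
    have k4 := Finset.card_union_le (U \ endpoints A) (endpoints (pairsInside A U))
    have k5 : (endpoints (pairsInside A U)).card ≤ 2 * (pairsInside A U).card := by
      have := Finset.card_union_le ((pairsInside A U).image Prod.fst)
        ((pairsInside A U).image Prod.snd)
      have := Finset.card_image_le (s := pairsInside A U) (f := Prod.fst)
      have := Finset.card_image_le (s := pairsInside A U) (f := Prod.snd)
      unfold endpoints
      omega
    have k6 := Finset.card_image_le (s := A.filter (· ∈ σ)) (f := ψ)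
    have k7 := Finset.card_image_le (s := pairsMeeting A Sat) (f := ψ)
    have k8 := card_pairsMeeting_le hA hlA Sat
    omega
  set Q := M.filter fun e => Good e.1 ∧ Good e.2 with hQ
  have hMU : ∀ e ∈ M, e.1 ∈ U ∧ e.2 ∈ U := by
    intro e he
    rw [← hMe]
    exact ⟨mem_endpoints.2 ⟨e, he, Or.inl rfl⟩, mem_endpoints.2 ⟨e, he, Or.inr rfl⟩⟩
  -- A bad vertex spoils at most one greedy edge.
  have hQc : τ ≤ Q.card + Bad.card := by
    have h1 : M ⊆ Q ∪ pairsMeeting M Bad := by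
      intro e he
      have := hMU e he
      simp only [hQ, hBad, pairsMeeting, Finset.mem_union, Finset.mem_filter]
      by_cases h1 : Good e.1
      · by_cases h2 : Good e.2
        · exact Or.inl ⟨he, h1, h2⟩
        · exact Or.inr ⟨he, Or.inr ⟨this.2, h2⟩⟩
      · exact Or.inr ⟨he, Or.inl ⟨this.1, h1⟩⟩
    have h2 := Finset.card_le_card h1
    have h3 := Finset.card_union_le Q (pairsMeeting M Bad)
    have h4 := card_pairsMeeting_le hMd hMl Bad
    omega
  -- This is the reason for the cap 2 inside `U`. If both edges of `A` were kept, their outer ends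
  -- differ because `A` is a matching; otherwise one endpoint has two kept neighbours, and one of
  -- them differs from the partner of the other endpoint.
  have hpair : ∀ e : V × V, ∃ x y, e ∈ Q → Nbr e.1 x ∧ Nbr e.2 y ∧ x ≠ y := by
    intro e
    by_cases heQ : e ∈ Q
    · obtain ⟨heM, hg1, hg2⟩ := Finset.mem_filter.1 heQ
      obtain ⟨x, ⟨f, hf, hfx⟩, hx⟩ := hgood _ (hMU e heM).1 hg1
      obtain ⟨y, ⟨g, hg, hgy⟩, hy⟩ := hgood _ (hMU e heM).2 hg2
      have hxy : x ≠ y := by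
        rintro rfl
        have hfg : f = g := by
          refine hA f hf g hg x ?_ ?_
          · simp only [Sym2.eq_iff] at hfx; grind
          · simp only [Sym2.eq_iff] at hgy; grind
        subst hfg
        exact hMl e heM (Sym2.congr_left.1 (hfx.symm.trans hgy))
      rcases hx with hx | ⟨a, b, hab, ha, hb⟩
      · rcases hy with hy | ⟨c, d, hcd, hc, hd⟩
        · exact ⟨x, y, fun _ => ⟨hx, hy, hxy⟩⟩
        · by_cases hxc : x = c
          · exact ⟨x, d, fun _ => ⟨hx, hd, hxc ▸ hcd⟩⟩
          · exact ⟨x, c, fun _ => ⟨hx, hc, hxc⟩⟩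
      · obtain ⟨z, hz⟩ : ∃ z, Nbr e.2 z := by
          rcases hy with hy | ⟨c, d, -, hc, -⟩
          · exact ⟨y, hy⟩
          · exact ⟨c, hc⟩
        by_cases haz : a = z
        · exact ⟨b, z, fun _ => ⟨hb, hz, fun h => hab (haz.trans h.symm)⟩⟩
        · exact ⟨a, z, fun _ => ⟨ha, hz, haz⟩⟩
    · exact ⟨e.1, e.1, fun h => (heQ h).elim⟩
  choose x y hxy using hpair
  have hQM : Q ⊆ M := Finset.filter_subset _ _
  have hxU : ∀ e ∈ Q, x e ∉ U := fun e he => hNbrU _ _ (hMU e (hQM he)).1 (hxy e he).1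
  have hyU : ∀ e ∈ Q, y e ∉ U := fun e he => hNbrU _ _ (hMU e (hQM he)).2 (hxy e he).2.1
  obtain ⟨R, hRQ, hRc, hRd⟩ := exists_disjoint_augmentations Q x y (by
    intro z
    by_cases hz : z ∈ U
    · rw [Finset.card_eq_zero.2]
      · omega
      · rw [Finset.filter_eq_empty_iff]
        intro e he h
        have := hxU e he
        have := hyU e he
        grind
    -- Different greedy edges with candidate `z` use different kept edges at `z`, of which there are
    -- at most 8.
    · set T := ((F.filter fun p => p.1 = z ∨ p.2 = z).map fun e => s(e.1, e.2)).toFinset with hT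
      have hTc : T.card ≤ 8 := by
        refine (List.toFinset_card_le _).trans ?_
        rw [List.length_map, ← List.countP_eq_length_filter]
        have := hdeg z
        rwa [degreeCap, if_neg hz] at this
      have hTm : ∀ v, Nbr v z → s(v, z) ∈ T := by
        intro v hv
        simp only [hNbr, List.mem_map] at hv
        obtain ⟨e, he, h⟩ := hv
        rw [hT, List.mem_toFinset, List.mem_map]
        refine ⟨e, List.mem_filter.2 ⟨he, ?_⟩, h⟩
        simp only [Sym2.eq_iff] at h
        simp only [decide_eq_true_eq]
        grind
      refine le_trans (Finset.card_le_card_of_injOn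
        (fun e => if x e = z then s(e.1, z) else s(e.2, z)) ?_ ?_) hTc
      · intro e he
        obtain ⟨he, hez⟩ := Finset.mem_filter.1 he
        have h := hxy e he
        simp only
        split_ifs with hc
        · exact hTm _ (hc ▸ h.1)
        · exact hTm _ ((hez.resolve_left hc) ▸ h.2.1)
      · intro p hp q hq h
        have hp := hQM (Finset.mem_filter.1 hp).1
        have hq := hQM (Finset.mem_filter.1 hq).1
        simp only at h
        split_ifs at h <;> have h := Sym2.congr_left.1 h
        · exact hMd p hp q hq _ (Or.inl h) (Or.inl rfl)
        · exact hMd p hp q hq _ (Or.inl h) (Or.inr rfl)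
        · exact hMd p hp q hq _ (Or.inr h) (Or.inl rfl)
        · exact hMd p hp q hq _ (Or.inr h) (Or.inr rfl))
  obtain ⟨N, hN, hNc, hNe⟩ := exists_augmented_matching hMd hMl (hRQ.trans hQM) x y
    (fun e he => hMe ▸ hxU e (hRQ he)) (fun e he => hMe ▸ hyU e (hRQ he))
    (fun e he => (hxy e (hRQ he)).2.2) hRd
  -- The arithmetic is `32 * N.card = 32 * τ + 32 * R.card ≥ 32 * τ + 2 * Q.card`, where `Q.card ≥ τ
  -- - Bad.card` and twice the contribution of `Sat` to `Bad` is at most `τ`.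
  refine ⟨N, hN, ?_, by omega⟩
  intro e he
  rcases hNe e he with ⟨p, hp, rfl⟩ | ⟨p, hp, h⟩
  · exact ⟨p, List.mem_append_left _ (List.mem_toFinset.1 hp), rfl⟩
  · have h' := hxy p (hRQ hp)
    simp only [hNbr, List.mem_map] at h'
    obtain ⟨⟨f, hf, hf'⟩, ⟨g, hg, hg'⟩, -⟩ := h'
    rcases h with rfl | rfl
    · exact ⟨f, List.mem_append_right _ hf, hf'.symm⟩
    · exact ⟨g, List.mem_append_right _ hg, hg'.symm⟩

/-- The greedy matching has more than half as many edges as `A`, unless `A` meets the vertices of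
an initial part of it in the typical way. -/
theorem two_mul_length_greedy_ge {σ ρ : List (V × V)} (hl : ∀ e ∈ σ ++ ρ, e.1 ≠ e.2)
    {A : Finset (V × V)} (hA : PairsDisjoint A) (hAσ : ∀ e ∈ A, e ∈ σ ++ ρ) :
    A.card + (pairsInside A (coveredVertices (greedy σ))).card
      + (coveredVertices (greedy σ) \ endpoints A).card ≤ 2 * (greedy (σ ++ ρ)).length := by
  set U := coveredVertices (greedy σ) with hU
  set W := coveredVertices (greedy (σ ++ ρ)) with hW
  have hlA : ∀ e ∈ A, e.1 ≠ e.2 := fun e he => hl e (hAσ e he)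
  have hUW : U ⊆ W := coveredVertices_mono (greedy_prefix σ ρ).subset
  have h1 := card_pairsMeeting_add_card_pairsInside hA hlA U
  have h2 := card_pairsMeeting_le hA hlA (W \ U)
  -- By maximality each edge of `A` meets `W`. At most `(W \ U).card` of them meet `W \ U`, while
  -- the number that meet `U` falls short of `U.card` by exactly the two correction terms of the
  -- claim.
  have h3 : A ⊆ pairsMeeting A U ∪ pairsMeeting A (W \ U) := by
    intro e he
    have := greedy_covers (hAσ e he)
    simp only [pairsMeeting, Finset.mem_union, Finset.mem_filter, Finset.mem_sdiff]
    tauto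
  have h4 := Finset.card_le_card h3
  have h5 := Finset.card_union_le (pairsMeeting A U) (pairsMeeting A (W \ U))
  have h6 := Finset.card_sdiff_add_card_inter U (endpoints A)
  have h7 := Finset.card_sdiff_add_card_eq_card hUW
  have h8 : W.card = 2 * (greedy (σ ++ ρ)).length := card_coveredVertices_greedy hl
  omega

end Deterministic

/-! ### Random order: how many good edges does the greedy matching contain? -/

section RandomOrder

variable {n : ℕ} (I : InjectionInstance n)

theorem InjectionInstance.length_stream (π : Equiv.Perm {i // i ∈ I.good}) :
    (I.stream π).length = I.m := by
  simp [InjectionInstance.stream]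

theorem InjectionInstance.getElem_stream (π : Equiv.Perm {i // i ∈ I.good}) (i : ℕ)
    (h : i < (I.stream π).length) :
    (I.stream π)[i] = I.edge (Equiv.Perm.ofSubtype π ⟨i, I.length_stream π ▸ h⟩) := by
  simp [InjectionInstance.stream]

theorem InjectionInstance.edge_mem_take_stream (π : Equiv.Perm {i // i ∈ I.good}) {i : Fin I.m}
    {p : ℕ} (h : (i : ℕ) < p) : I.edge (Equiv.Perm.ofSubtype π i) ∈ (I.stream π).take p := by
  rw [List.mem_take_iff_getElem]
  have hi : (i : ℕ) < (I.stream π).length := by rw [I.length_stream]; exact i.2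
  exact ⟨i, lt_min h hi, I.getElem_stream π i hi⟩

theorem InjectionInstance.mem_take_stream_iff (π : Equiv.Perm {i // i ∈ I.good})
    {p : ℕ} {e : Fin n × Fin n} :
    e ∈ (I.stream π).take p ↔
      ∃ i : Fin I.m, (i : ℕ) < p ∧ I.edge (Equiv.Perm.ofSubtype π i) = e := by
  constructor
  · rw [List.mem_take_iff_getElem]
    rintro ⟨i, hi, rfl⟩
    have hi' := lt_min_iff.1 hi
    exact ⟨⟨i, I.length_stream π ▸ hi'.2⟩, hi'.1, (I.getElem_stream π i hi'.2).symm⟩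
  · rintro ⟨i, hi, rfl⟩
    exact I.edge_mem_take_stream π hi

theorem InjectionInstance.take_stream_congr {π π' : Equiv.Perm {i // i ∈ I.good}} {p : ℕ}
    (h : ∀ i : Fin I.m, (i : ℕ) < p →
      Equiv.Perm.ofSubtype π i = Equiv.Perm.ofSubtype π' i) :
    (I.stream π).take p = (I.stream π').take p := by
  refine List.ext_getElem (by simp [I.length_stream]) fun i h1 h2 => ?_
  rw [List.getElem_take, List.getElem_take, I.getElem_stream, I.getElem_stream]
  rw [h]
  simp only [List.length_take, lt_min_iff] at h1
  exact h1.1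

theorem InjectionInstance.stream_loopless (π : Equiv.Perm {i // i ∈ I.good}) :
    ∀ e ∈ I.stream π, e.1 ≠ e.2 := by
  intro e he
  simp only [InjectionInstance.stream, List.mem_ofFn] at he
  obtain ⟨i, rfl⟩ := he
  exact I.loopless _

theorem InjectionInstance.stream_nodup (π : Equiv.Perm {i // i ∈ I.good}) :
    ((I.stream π).map fun e => s(e.1, e.2)).Nodup := by
  rw [InjectionInstance.stream, List.map_ofFn, List.nodup_ofFn]
  exact I.distinct.comp (Equiv.Perm.ofSubtype π).injective

theorem InjectionInstance.edge_injective : Function.Injective I.edge :=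
  fun _ _ h => I.distinct (by simp only [h])

/-- The edge at a good position of the original order of arrival. -/
def InjectionInstance.goodEdge (i : {i // i ∈ I.good}) : Fin n × Fin n := I.edge i

theorem InjectionInstance.goodEdge_injective : Function.Injective I.goodEdge :=
  I.edge_injective.comp Subtype.val_injective

theorem List.take_prefix_take_of_le {α : Type*} {p q : ℕ} (h : p ≤ q) (l : List α) :
    l.take p <+: l.take q :=
  ⟨(l.take q).drop p, by
    have := List.take_append_drop p (l.take q)
    rwa [List.take_take, min_eq_left h] at this⟩

/-- The greedy matching of the first `p` edges. -/
def InjectionInstance.greedyBefore (π : Equiv.Perm {i // i ∈ I.good}) (p : ℕ) :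
    List (Fin n × Fin n) := greedy ((I.stream π).take p)

/-- The edge `e` meets no greedy edge among the first `p` edges. -/
def InjectionInstance.Fresh (π : Equiv.Perm {i // i ∈ I.good}) (p : ℕ) (e : Fin n × Fin n) :
    Prop :=
  e.1 ∉ coveredVertices (I.greedyBefore π p) ∧ e.2 ∉ coveredVertices (I.greedyBefore π p)

instance (π : Equiv.Perm {i // i ∈ I.good}) (p : ℕ) (e : Fin n × Fin n) :
    Decidable (I.Fresh π p e) := inferInstanceAs (Decidable (_ ∧ _))

/-! ### Edges of `A` that arrive before the threshold is reached -/

variable (A : Finset {i // i ∈ I.good})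

/-- The positions before the greedy matching has size `τ` at which an edge of `A` arrives. -/
def InjectionInstance.arrivals (τ : ℕ) (π : Equiv.Perm {i // i ∈ I.good}) :
    Finset {i // i ∈ I.good} :=
  Finset.univ.filter fun q => (I.greedyBefore π q).length < τ ∧ π q ∈ A

/-- The positions in `arrivals` whose edge is taken by the greedy algorithm. -/
def InjectionInstance.freshArrivals (τ : ℕ) (π : Equiv.Perm {i // i ∈ I.good}) :
    Finset {i // i ∈ I.good} :=
  (I.arrivals A τ π).filter fun q => I.Fresh π q (I.goodEdge (π q))

variable {A}

/-- Each of the two endpoints of a greedy edge makes at most one edge of the matching `A` non-fresh.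
-/
theorem InjectionInstance.card_le_card_fresh
    (hA : PairsDisjoint (A.image I.goodEdge)) (π : Equiv.Perm {i // i ∈ I.good}) (p : ℕ) :
    A.card ≤ (A.filter fun e => I.Fresh π p (I.goodEdge e)).card
      + 2 * (I.greedyBefore π p).length := by
  set B := A.image I.goodEdge with hB
  set W := coveredVertices (I.greedyBefore π p) with hW
  have hinj : Function.Injective I.goodEdge := I.goodEdge_injective
  have hBl : ∀ e ∈ B, e.1 ≠ e.2 := by
    intro e he
    obtain ⟨i, -, rfl⟩ := Finset.mem_image.1 he
    exact I.loopless _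
  have h1 : A.card = B.card := (Finset.card_image_of_injective _ hinj).symm
  have h2 := card_pairsMeeting_le hA hBl W
  have h3 : W.card = 2 * (I.greedyBefore π p).length :=
    card_coveredVertices_greedy fun e he => I.stream_loopless π e (List.mem_of_mem_take he)
  have h4 : B ⊆ ((A.filter fun e => I.Fresh π p (I.goodEdge e)).image I.goodEdge)
      ∪ pairsMeeting B W := by
    intro e he
    have heB := he
    obtain ⟨i, hi, rfl⟩ := Finset.mem_image.1 he
    simp only [Finset.mem_union, Finset.mem_image, Finset.mem_filter, pairsMeeting]
    by_cases hf : I.Fresh π p (I.edge i)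
    · exact Or.inl ⟨i, ⟨hi, hf⟩, rfl⟩
    · refine Or.inr ⟨heB, ?_⟩
      unfold InjectionInstance.Fresh at hf
      tauto
  have h5 := Finset.card_le_card h4
  have h6 := Finset.card_union_le
    ((A.filter fun e => I.Fresh π p (I.goodEdge e)).image I.goodEdge) (pairsMeeting B W)
  have h7 := Finset.card_image_le (s := A.filter fun e => I.Fresh π p (I.goodEdge e))
    (f := I.goodEdge)
  omega

/-- Exchanging the edge that arrives at position `q` with a fresh edge does not change what
happened before. -/
theorem InjectionInstance.greedyBefore_swap {π : Equiv.Perm {i // i ∈ I.good}}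
    {q e : {i // i ∈ I.good}} (he : I.Fresh π q (I.goodEdge e)) :
    I.greedyBefore (Equiv.swap (π q) e * π) q = I.greedyBefore π q := by
  unfold InjectionInstance.greedyBefore
  rw [I.take_stream_congr]
  intro i hi
  by_cases hg : i ∈ I.good
  · rw [Equiv.Perm.ofSubtype_apply_of_mem _ hg, Equiv.Perm.ofSubtype_apply_of_mem _ hg,
      Equiv.Perm.mul_apply, Equiv.swap_apply_of_ne_of_ne]
    · intro h
      have := π.injective h
      rw [← this] at hi
      exact lt_irrefl _ hi
    -- A fresh edge cannot sit at an earlier position, since `greedy_covers` would make it meet the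
    -- greedy matching.
    · intro h
      have hm := I.edge_mem_take_stream π hi
      rw [Equiv.Perm.ofSubtype_apply_of_mem _ hg, h] at hm
      rcases greedy_covers hm with h | h
      · exact he.1 h
      · exact he.2 h
  · rw [Equiv.Perm.ofSubtype_apply_of_not_mem _ hg, Equiv.Perm.ofSubtype_apply_of_not_mem _ hg]

/-- At every time before the greedy matching has size `τ`, many edges of `A` are fresh, and each of
the remaining edges of `A` is equally likely to arrive next. -/
theorem InjectionInstance.sum_card_arrivals_le
    (hA : PairsDisjoint (A.image I.goodEdge)) (τ : ℕ) :
    (A.card + 2) * ∑ π, (I.arrivals A τ π).card ≤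
      A.card * ∑ π, (I.freshArrivals A τ π).card + 2 * τ * ∑ π, (I.arrivals A τ π).card := by
  classical
  have hX : ∑ π, (I.arrivals A τ π).card = ∑ q : {i // i ∈ I.good},
      (Finset.univ.filter fun π => (I.greedyBefore π q).length < τ ∧ π q ∈ A).card := by
    simp only [InjectionInstance.arrivals, Finset.card_filter]
    exact Finset.sum_comm
  have hD : ∑ π, (I.freshArrivals A τ π).card = ∑ q : {i // i ∈ I.good},
      (Finset.univ.filter fun π => ((I.greedyBefore π q).length < τ ∧ π q ∈ A) ∧
        I.Fresh π q (I.goodEdge (π q))).card := by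
    simp only [InjectionInstance.freshArrivals, InjectionInstance.arrivals, Finset.filter_filter,
      Finset.card_filter]
    exact Finset.sum_comm
  rw [hX, hD, Finset.mul_sum, Finset.mul_sum, Finset.mul_sum, ← Finset.sum_add_distrib]
  refine Finset.sum_le_sum fun q _ => ?_
  set Ω := Finset.univ.filter fun π : Equiv.Perm {i // i ∈ I.good} =>
    (I.greedyBefore π q).length < τ ∧ π q ∈ A with hΩ
  set Ω' := Finset.univ.filter fun π : Equiv.Perm {i // i ∈ I.good} =>
    ((I.greedyBefore π q).length < τ ∧ π q ∈ A) ∧ I.Fresh π q (I.goodEdge (π q)) with hΩ'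
  -- Double counting at a fixed position `q`: orders at which an edge of `A` arrives too early for
  -- the threshold, together with a fresh edge that could have arrived instead.
  set P := Ω.sigma fun π => A.filter fun e => I.Fresh π q (I.goodEdge e) with hP
  have h1 : (A.card + 2) * Ω.card ≤ P.card + 2 * τ * Ω.card := by
    rw [hP, Finset.card_sigma, mul_comm, mul_comm (2 * τ), ← smul_eq_mul, ← smul_eq_mul,
      ← Finset.sum_const, ← Finset.sum_const, ← Finset.sum_add_distrib]
    refine Finset.sum_le_sum fun π hπ => ?_
    -- Greedy has at most `τ - 1` edges here, which yields at least `A.card + 2 - 2 * τ` fresh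
    -- edges. The extra 2 absorbs the rounding in the choice of `τ`.
    have h := I.card_le_card_fresh hA π q
    have h' := (Finset.mem_filter.1 hπ).2.1
    omega
  -- Let the fresh edge arrive at `q` instead, and remember the edge that was displaced. The past is
  -- unchanged, so the result lies in `Ω'`; the new edge at `q` and the remembered one determine the
  -- swap, hence the original order.
  have h2 : P.card ≤ (Ω' ×ˢ A).card := by
    refine Finset.card_le_card_of_injOn
      (fun x => (Equiv.swap (x.1 q) x.2 * x.1, x.1 q)) ?_ ?_
    · rintro ⟨π, e⟩ h
      simp only [hP, hΩ, Finset.coe_sigma, Set.mem_sigma_iff, Finset.mem_coe,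
        Finset.mem_filter, Finset.mem_univ, true_and] at h
      obtain ⟨⟨hlt, hqA⟩, heA, hef⟩ := h
      have hb := I.greedyBefore_swap hef
      have hs : (Equiv.swap (π q) e * π) q = e := by simp
      simp only [hΩ', Finset.mem_coe, Finset.mem_product, Finset.mem_filter,
        Finset.mem_univ, true_and]
      rw [hs, InjectionInstance.Fresh, hb]
      exact ⟨⟨⟨hlt, heA⟩, hef⟩, hqA⟩
    · rintro ⟨π, e⟩ - ⟨π', e'⟩ - h
      simp only [Prod.mk.injEq] at h
      obtain ⟨h, hq⟩ := h
      have he : e = e' := by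
        have := congrArg (fun σ => σ q) h
        simp only [Equiv.Perm.mul_apply, Equiv.swap_apply_left] at this
        exact this
      subst he
      rw [hq] at h
      have := mul_left_cancel h
      rw [this]
  rw [Finset.card_product] at h2
  have : A.card * Ω'.card = Ω'.card * A.card := mul_comm _ _
  omega

/-- The size of the greedy matching starts at 0, never decreases and grows by at most one per edge,
so the value `τ` is attained exactly at the first time when it is reached. -/
theorem InjectionInstance.exists_stopping_time (π : Equiv.Perm {i // i ∈ I.good}) {τ : ℕ}
    (hτ : τ ≤ (greedy (I.stream π)).length) :
    ∃ T, (I.greedyBefore π T).length = τ ∧ ∀ p, (I.greedyBefore π p).length < τ ↔ p < T := by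
  have hex : ∃ T, τ ≤ (I.greedyBefore π T).length := by
    refine ⟨(I.stream π).length, ?_⟩
    rwa [InjectionInstance.greedyBefore, List.take_length]
  have hmono : ∀ p q, p ≤ q → (I.greedyBefore π p).length ≤ (I.greedyBefore π q).length := by
    intro p q hpq
    obtain ⟨t, ht⟩ := List.take_prefix_take_of_le hpq (I.stream π)
    unfold InjectionInstance.greedyBefore
    rw [← ht]
    exact (greedy_prefix _ _).length_le
  refine ⟨Nat.find hex, le_antisymm ?_ (Nat.find_spec hex), fun p => ?_⟩
  · by_cases h0 : Nat.find hex = 0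
    · rw [h0]
      simp [InjectionInstance.greedyBefore, greedy]
    · obtain ⟨t, ht⟩ := Nat.exists_eq_succ_of_ne_zero h0
      have hlt : (I.greedyBefore π t).length < τ := not_le.1 (Nat.find_min hex (by omega))
      rw [ht]
      unfold InjectionInstance.greedyBefore at hlt ⊢
      rw [Nat.succ_eq_add_one]
      rcases lt_or_ge t (I.stream π).length with h | h
      · rw [List.take_succ_eq_append_getElem h, greedy_snoc, greedyStep]
        split_ifs
        · omega
        · rw [List.length_append, List.length_singleton]; omega
      · rw [List.take_of_length_le (by omega)]
        rw [List.take_of_length_le h] at hlt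
        omega
  · constructor
    · intro h
      by_contra hc
      have := hmono _ _ (not_lt.1 hc)
      have := Nat.find_spec hex
      omega
    · intro h
      exact not_le.1 (Nat.find_min hex h)

/-- What is guaranteed for every order of arrival. -/
theorem InjectionInstance.stream_bound
    (hA : PairsDisjoint (A.image I.goodEdge)) (π : Equiv.Perm {i // i ∈ I.good}) {τ c : ℕ}
    (hτ : 2 * τ ≤ A.card + 1)
    (hc : ∀ N : Finset (Sym2 (Fin n)), IsMatching N →
      (∀ e ∈ N, ∃ p ∈ greedy (I.stream π) ++ run τ (I.stream π), e = s(p.1, p.2)) → N.card ≤ c) :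
    204 * A.card + 33 * τ + 200 * (I.freshArrivals A τ π).card ≤
      440 * c + 2 * (I.arrivals A τ π).card := by
  set B := A.image I.goodEdge with hB
  have hl := I.stream_loopless π
  have hinj : Function.Injective I.goodEdge := I.goodEdge_injective
  have hBA : B.card = A.card := Finset.card_image_of_injective _ hinj
  have hBσ : ∀ e ∈ B, e ∈ I.stream π := by
    intro e he
    obtain ⟨i, -, rfl⟩ := Finset.mem_image.1 he
    rw [InjectionInstance.stream, List.mem_ofFn]
    refine ⟨(π.symm i : {i // i ∈ I.good}), ?_⟩
    simp [InjectionInstance.goodEdge]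
  -- The split at time 0 gives the classical factor `1 / 2`, which guarantees that the threshold is
  -- reached.
  have hG : A.card ≤ 2 * (greedy (I.stream π)).length := by
    have := two_mul_length_greedy_ge (σ := []) (ρ := I.stream π) hl hA hBσ
    rw [List.nil_append] at this
    omega
  obtain ⟨T, hT, hTp⟩ := I.exists_stopping_time π (τ := τ) (by omega)
  have hsplit := List.take_append_drop T (I.stream π)
  set σ := (I.stream π).take T with hσ
  set ρ := (I.stream π).drop T with hρ
  have h1 := two_mul_length_greedy_ge (σ := σ) (ρ := ρ) (by rwa [hsplit]) hA (by rwa [hsplit])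
  obtain ⟨N, hN, hNe, hNc⟩ := exists_matching_run (σ := σ) (ρ := ρ)
    (by rw [hsplit]; exact I.stream_nodup π) (by rwa [hsplit]) hT hA (by rwa [hsplit])
  rw [hsplit] at h1 hNe
  obtain ⟨N', hN', hNc', hNe'⟩ := exists_matching_greedy hl
  have h2 := hc N hN (by
    intro e he
    obtain ⟨p, hp, h⟩ := hNe e he
    refine ⟨p, ?_, h⟩
    rcases List.mem_append.1 hp with hp | hp
    · have := (greedy_prefix σ ρ).subset hp
      rw [hsplit] at this
      exact List.mem_append_left _ this
    · exact List.mem_append_right _ hp)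
  have h3 := hc N' hN' (by
    intro e he
    obtain ⟨p, hp, h⟩ := hNe' e he
    exact ⟨p, List.mem_append_left _ hp, h⟩)
  have hX : (B.filter (· ∈ σ)).card ≤ (I.arrivals A τ π).card := by
    refine le_trans (Finset.card_le_card (t := (I.arrivals A τ π).image fun q => I.goodEdge (π q)) ?_)
      Finset.card_image_le
    intro e he
    obtain ⟨heB, heσ⟩ := Finset.mem_filter.1 he
    obtain ⟨j, hj, rfl⟩ := Finset.mem_image.1 heB
    obtain ⟨i, hiT, hi⟩ := (I.mem_take_stream_iff π).1 heσ
    have hi' : Equiv.Perm.ofSubtype π i = (j : Fin I.m) := I.edge_injective hi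
    have hig : i ∈ I.good := by
      by_contra hig
      rw [Equiv.Perm.ofSubtype_apply_of_not_mem _ hig] at hi'
      exact hig (hi' ▸ j.2)
    rw [Equiv.Perm.ofSubtype_apply_of_mem _ hig] at hi'
    have hi'' := Subtype.ext hi'
    refine Finset.mem_image.2 ⟨⟨i, hig⟩, ?_, by rw [hi'']⟩
    simp only [InjectionInstance.arrivals, Finset.mem_filter, Finset.mem_univ, true_and]
    exact ⟨(hTp i).2 hiT, hi'' ▸ hj⟩
  -- A fresh edge at a position `q < T` is taken by greedy at once, so both its endpoints are
  -- covered by time `T`.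
  have hD : (I.freshArrivals A τ π).card ≤ (pairsInside B (coveredVertices (greedy σ))).card := by
    refine Finset.card_le_card_of_injOn (fun q => I.goodEdge (π q)) ?_
      (hinj.comp π.injective).injOn
    intro q hq
    simp only [InjectionInstance.freshArrivals, InjectionInstance.arrivals, Finset.mem_coe,
      Finset.mem_filter, Finset.mem_univ, true_and] at hq
    obtain ⟨⟨hlt, hqA⟩, hf⟩ := hq
    have hqT := (hTp _).1 hlt
    have hql : (q : ℕ) < (I.stream π).length := by rw [I.length_stream]; exact q.1.2
    have hmem : I.goodEdge (π q) ∈ I.greedyBefore π (q + 1) := by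
      have hf' := hf
      unfold InjectionInstance.Fresh at hf'
      unfold InjectionInstance.greedyBefore at hf' ⊢
      rw [List.take_succ_eq_append_getElem hql, greedy_snoc, I.getElem_stream]
      have : I.edge (Equiv.Perm.ofSubtype π q) = I.goodEdge (π q) := by
        simp [InjectionInstance.goodEdge]
      simp only [Fin.eta, this]
      rw [greedyStep, if_neg (by tauto)]
      simp
    have hsub : I.greedyBefore π (q + 1) ⊆ greedy σ := by
      obtain ⟨t, ht⟩ := List.take_prefix_take_of_le (Nat.succ_le_of_lt hqT) (I.stream π)
      unfold InjectionInstance.greedyBefore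
      rw [hσ, ← ht]
      exact (greedy_prefix _ _).subset
    have hm := hsub hmem
    simp only [pairsInside, Finset.mem_coe, Finset.mem_filter]
    exact ⟨Finset.mem_image_of_mem _ hqA, mem_coveredVertices.2 ⟨_, hm, Or.inl rfl⟩,
      mem_coveredVertices.2 ⟨_, hm, Or.inr rfl⟩⟩
  -- The sum of 204 times `h1` and `hNc`. Since `204 - 4 = 200`, the coefficient of `D` becomes 100
  -- times that of `X`, and the coefficient of the missed vertices stays positive, so that term can
  -- be dropped.
  omega

theorem InjectionInstance.expect_bound
    (hA : PairsDisjoint (A.image I.goodEdge)) {τ : ℕ}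
    (hτ : 200 * τ ≤ 99 * A.card + 200) (hτ' : 49 * A.card ≤ 100 * τ) (hA0 : 0 < A.card)
    (c : Equiv.Perm {i // i ∈ I.good} → ℕ)
    (hc : ∀ π, ∀ N : Finset (Sym2 (Fin n)), IsMatching N →
      (∀ e ∈ N, ∃ p ∈ greedy (I.stream π) ++ run τ (I.stream π), e = s(p.1, p.2)) →
        N.card ≤ c π) :
    (1 / 2 + 1 / 2600) * (A.card : ℝ) ≤
      Finset.expect Finset.univ fun π : Equiv.Perm {i // i ∈ I.good} => (c π : ℝ) := by
  have h1 := Finset.sum_le_sum fun π (_ : π ∈ Finset.univ) =>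
    -- The hypothesis `2 * τ ≤ A.card + 1` follows by integrality from `2 * τ ≤ 0.99 * A.card + 2`
    -- and `0 < A.card`.
    I.stream_bound hA π (by omega) (hc π)
  have h2 := I.sum_card_arrivals_le hA τ
  simp only [Finset.sum_add_distrib, ← Finset.mul_sum, Finset.sum_const, smul_eq_mul] at h1
  set X := ∑ π, (I.arrivals A τ π).card
  set D := ∑ π, (I.freshArrivals A τ π).card
  set K := (Finset.univ : Finset (Equiv.Perm {i // i ∈ I.good})).card with hK
  have hKpos : 0 < K := Finset.card_pos.2 ⟨1, Finset.mem_univ _⟩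
  rw [Finset.expect_eq_sum_div_card, ← hK, le_div_iff₀ (by exact_mod_cast hKpos),
    ← Nat.cast_sum]
  set C := ∑ π, c π
  have h3 : (K : ℝ) * (204 * A.card + 33 * τ) + 200 * D ≤ 440 * C + 2 * X := by
    have h1' : K * (204 * A.card + 33 * τ) + 200 * D ≤ 440 * C + 2 * X := by linarith
    exact_mod_cast h1'
  have h4 : ((A.card : ℝ) + 2) * X ≤ A.card * D + 2 * τ * X := by exact_mod_cast h2
  have h5 : (200 : ℝ) * τ ≤ 99 * A.card + 200 := by exact_mod_cast hτ
  have h6 : (49 : ℝ) * A.card ≤ 100 * τ := by exact_mod_cast hτ'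
  have hN : (0 : ℝ) < A.card := by exact_mod_cast hA0
  have hX : (0 : ℝ) ≤ X := Nat.cast_nonneg _
  have hK' : (0 : ℝ) < K := by exact_mod_cast hKpos
  -- By the upper bound on `τ`, `A.card + 2 - 2 * τ ≥ A.card / 100`.
  have h7 : (X : ℝ) ≤ 100 * D := by
    have : (A.card : ℝ) * X ≤ A.card * (100 * D) := by nlinarith
    exact le_of_mul_le_mul_left this hN
  -- With `2 * X ≤ 200 * D` and `τ ≥ 0.49 * A.card`, the mean of `c` is at least `(204 + 33 * 0.49)
  -- / 440 * A.card = 220.17 / 440 * A.card`, and `0.17 / 440 > 1 / 2600`.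
  nlinarith [mul_le_mul_of_nonneg_left h6 hK'.le, mul_pos hK' hN]

/-- A maximum matching in the set of good edges. -/
theorem InjectionInstance.exists_maximum_matching :
    ∃ A : Finset {i // i ∈ I.good}, PairsDisjoint (A.image I.goodEdge) ∧
      A.card = matchingNumber I.goodEdges := by
  classical
  obtain ⟨M, hM, hMc⟩ := Finset.exists_mem_eq_sup
    (I.goodEdges.powerset.filter fun M => IsMatching M)
    ⟨∅, by simp [isMatching_iff]⟩ Finset.card
  simp only [Finset.mem_filter, Finset.mem_powerset] at hM
  set A : Finset {i // i ∈ I.good} :=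
    Finset.univ.filter fun i => s((I.goodEdge i).1, (I.goodEdge i).2) ∈ M with hA
  refine ⟨A, ?_, ?_⟩
  · intro p hp q hq v hpv hqv
    obtain ⟨i, hi, rfl⟩ := Finset.mem_image.1 hp
    obtain ⟨j, hj, rfl⟩ := Finset.mem_image.1 hq
    simp only [hA, Finset.mem_filter, Finset.mem_univ, true_and] at hi hj
    have := isMatching_iff.1 hM.2 _ hi _ hj v
      (by rw [Sym2.mem_iff]; grind) (by rw [Sym2.mem_iff]; grind)
    rw [Subtype.ext (I.distinct this)]
  · have h : A.image (fun i => s((I.goodEdge i).1, (I.goodEdge i).2)) = M := by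
      ext e
      simp only [hA, Finset.mem_image, Finset.mem_filter, Finset.mem_univ, true_and]
      constructor
      · rintro ⟨i, hi, rfl⟩
        exact hi
      · intro he
        obtain ⟨i, hi, rfl⟩ := Finset.mem_image.1 (hM.1 he)
        exact ⟨⟨i, hi⟩, he, rfl⟩
    unfold matchingNumber
    rw [hMc, ← h, Finset.card_image_of_injective]
    exact I.distinct.comp Subtype.val_injective

end RandomOrder

/-! ### Reasoning about programs -/

/-- The memory of the matching program: six arrays and ten single cells. -/
structure MatchMem where
  /-- the position of the greedy edge that covers a vertex, counted from `1`, or `0` -/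
  ord : ℕ → ℕ
  /-- the degrees in the sets of edges kept for the various thresholds -/
  deg : ℕ → ℕ
  /-- the first endpoints of the stored edges -/
  left : ℕ → ℕ
  /-- the second endpoints of the stored edges -/
  right : ℕ → ℕ
  /-- the set of stored edges that is being examined -/
  sel : ℕ → ℕ
  /-- the largest matching found -/
  best : ℕ → ℕ
  /-- the size of the greedy matching -/
  cnt : ℕ
  /-- the number of stored edges -/
  len : ℕ
  /-- the index of a threshold -/
  idx : ℕ
  /-- a threshold -/
  thr : ℕ
  /-- whether all sets of stored edges were examined -/
  halt : ℕ
  /-- a position in the list of stored edges -/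
  pos : ℕ
  /-- another position in the list of stored edges -/
  aux : ℕ
  /-- the size of the set that is being examined -/
  size : ℕ
  /-- whether the set that is being examined is a matching -/
  ok : ℕ
  /-- the size of the largest matching found -/
  top : ℕ

/-- An array whose only cell in use is the first one. -/
def singleCell (x : ℕ) : ℕ → ℕ := fun i => if i = 0 then x else 0

@[simp] theorem singleCell_zero (x : ℕ) : singleCell x 0 = x := rfl

@[simp] theorem update_singleCell (x y : ℕ) :
    Function.update (singleCell x) 0 y = singleCell y := by
  funext i
  by_cases h : i = 0
  · subst h; simp
  · simp [singleCell, h]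

namespace MatchMem

/-- The arrays of the program. -/
def toMem (m : MatchMem) : Fin 16 → ℕ → ℕ :=
  ![m.ord, m.deg, m.left, m.right, m.sel, m.best, singleCell m.cnt, singleCell m.len,
    singleCell m.idx, singleCell m.thr, singleCell m.halt, singleCell m.pos, singleCell m.aux,
    singleCell m.size, singleCell m.ok, singleCell m.top]

variable (m : MatchMem) (i x : ℕ)

@[simp] theorem toMem_ord : m.toMem 0 = m.ord := rfl
@[simp] theorem toMem_deg : m.toMem 1 = m.deg := rfl
@[simp] theorem toMem_left : m.toMem 2 = m.left := rfl
@[simp] theorem toMem_right : m.toMem 3 = m.right := rfl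
@[simp] theorem toMem_sel : m.toMem 4 = m.sel := rfl
@[simp] theorem toMem_best : m.toMem 5 = m.best := rfl
@[simp] theorem toMem_cnt : m.toMem 6 = singleCell m.cnt := rfl
@[simp] theorem toMem_len : m.toMem 7 = singleCell m.len := rfl
@[simp] theorem toMem_idx : m.toMem 8 = singleCell m.idx := rfl
@[simp] theorem toMem_thr : m.toMem 9 = singleCell m.thr := rfl
@[simp] theorem toMem_halt : m.toMem 10 = singleCell m.halt := rfl
@[simp] theorem toMem_pos : m.toMem 11 = singleCell m.pos := rfl
@[simp] theorem toMem_aux : m.toMem 12 = singleCell m.aux := rfl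
@[simp] theorem toMem_size : m.toMem 13 = singleCell m.size := rfl
@[simp] theorem toMem_ok : m.toMem 14 = singleCell m.ok := rfl
@[simp] theorem toMem_top : m.toMem 15 = singleCell m.top := rfl

theorem update_ord : Function.update m.toMem 0 (Function.update (m.toMem 0) i x) =
    toMem { m with ord := Function.update m.ord i x } := by
  funext a; fin_cases a <;> rfl
theorem update_deg : Function.update m.toMem 1 (Function.update (m.toMem 1) i x) =
    toMem { m with deg := Function.update m.deg i x } := by
  funext a; fin_cases a <;> rfl
theorem update_left : Function.update m.toMem 2 (Function.update (m.toMem 2) i x) =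
    toMem { m with left := Function.update m.left i x } := by
  funext a; fin_cases a <;> rfl
theorem update_right : Function.update m.toMem 3 (Function.update (m.toMem 3) i x) =
    toMem { m with right := Function.update m.right i x } := by
  funext a; fin_cases a <;> rfl
theorem update_sel : Function.update m.toMem 4 (Function.update (m.toMem 4) i x) =
    toMem { m with sel := Function.update m.sel i x } := by
  funext a; fin_cases a <;> rfl
theorem update_best : Function.update m.toMem 5 (Function.update (m.toMem 5) i x) =
    toMem { m with best := Function.update m.best i x } := by
  funext a; fin_cases a <;> rfl
theorem update_cnt : Function.update m.toMem 6 (Function.update (m.toMem 6) 0 x) =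
    toMem { m with cnt := x } := by
  rw [toMem_cnt, update_singleCell]; funext a; fin_cases a <;> rfl
theorem update_len : Function.update m.toMem 7 (Function.update (m.toMem 7) 0 x) =
    toMem { m with len := x } := by
  rw [toMem_len, update_singleCell]; funext a; fin_cases a <;> rfl
theorem update_idx : Function.update m.toMem 8 (Function.update (m.toMem 8) 0 x) =
    toMem { m with idx := x } := by
  rw [toMem_idx, update_singleCell]; funext a; fin_cases a <;> rfl
theorem update_thr : Function.update m.toMem 9 (Function.update (m.toMem 9) 0 x) =
    toMem { m with thr := x } := by
  rw [toMem_thr, update_singleCell]; funext a; fin_cases a <;> rfl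
theorem update_halt : Function.update m.toMem 10 (Function.update (m.toMem 10) 0 x) =
    toMem { m with halt := x } := by
  rw [toMem_halt, update_singleCell]; funext a; fin_cases a <;> rfl
theorem update_pos : Function.update m.toMem 11 (Function.update (m.toMem 11) 0 x) =
    toMem { m with pos := x } := by
  rw [toMem_pos, update_singleCell]; funext a; fin_cases a <;> rfl
theorem update_aux : Function.update m.toMem 12 (Function.update (m.toMem 12) 0 x) =
    toMem { m with aux := x } := by
  rw [toMem_aux, update_singleCell]; funext a; fin_cases a <;> rfl
theorem update_size : Function.update m.toMem 13 (Function.update (m.toMem 13) 0 x) =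
    toMem { m with size := x } := by
  rw [toMem_size, update_singleCell]; funext a; fin_cases a <;> rfl
theorem update_ok : Function.update m.toMem 14 (Function.update (m.toMem 14) 0 x) =
    toMem { m with ok := x } := by
  rw [toMem_ok, update_singleCell]; funext a; fin_cases a <;> rfl
theorem update_top : Function.update m.toMem 15 (Function.update (m.toMem 15) 0 x) =
    toMem { m with top := x } := by
  rw [toMem_top, update_singleCell]; funext a; fin_cases a <;> rfl

/-- The memory before the first step. -/
def zero : MatchMem where
  ord _ := 0
  deg _ := 0
  left _ := 0
  right _ := 0
  sel _ := 0
  best _ := 0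
  cnt := 0
  len := 0
  idx := 0
  thr := 0
  halt := 0
  pos := 0
  aux := 0
  size := 0
  ok := 0
  top := 0

theorem toMem_zero : zero.toMem = fun _ _ => 0 := by
  have h : singleCell 0 = fun _ => 0 := by funext i; simp [singleCell]
  funext a
  fin_cases a <;> first | rfl | exact h

end MatchMem

/-- Started with memory `m` and output `o`, the command `c` terminates within its space bounds in
a state that satisfies `Q`. -/
def Runs (inp : StreamInput) (S W : ℕ) (c : StreamCmd 16) (m : MatchMem) (o : List (ℕ × ℕ))
    (Q : MatchMem → List (ℕ × ℕ) → Prop) : Prop :=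
  ∃ m' o', StreamExec inp S W c ⟨m.toMem, o⟩ ⟨m'.toMem, o'⟩ ∧ Q m' o'

namespace Runs

variable {inp : StreamInput} {S W : ℕ} {m m' : MatchMem} {o : List (ℕ × ℕ)}
  {Q : MatchMem → List (ℕ × ℕ) → Prop}

theorem skip (h : Q m o) : Runs inp S W .skip m o Q := ⟨m, o, .skip _, h⟩

/-- The semantics produces a memory built with `Function.update`. The hypothesis `hm` trades it for
a record `m'`, and is supplied at each use by one of the `update_` lemmas of `MatchMem`. -/
theorem write {a : Fin 16} {i x : StreamExpr 16} {p v : ℕ} (hp : i.eval inp m.toMem = p)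
    (hv : x.eval inp m.toMem = v) (hS : p < S) (hW : v < 2 ^ W)
    (hm : Function.update m.toMem a (Function.update (m.toMem a) p v) = m'.toMem)
    (h : Q m' o) : Runs inp S W (.write a i x) m o Q := by
  subst hp hv
  exact ⟨m', o, hm ▸ StreamExec.write a i x ⟨m.toMem, o⟩ hS hW, h⟩

theorem emit {x y : StreamExpr 16}
    (h : Q m (o ++ [(x.eval inp m.toMem, y.eval inp m.toMem)])) :
    Runs inp S W (.emit x y) m o Q :=
  ⟨m, _, .emit x y ⟨m.toMem, o⟩, h⟩

theorem seq {c d : StreamCmd 16} (h : Runs inp S W c m o fun m o => Runs inp S W d m o Q) :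
    Runs inp S W (.seq c d) m o Q := by
  obtain ⟨m', o', hc, m'', o'', hd, hQ⟩ := h
  exact ⟨m'', o'', .seq hc hd, hQ⟩

theorem ite {b : StreamExpr 16} {c d : StreamCmd 16}
    (h1 : b.eval inp m.toMem ≠ 0 → Runs inp S W c m o Q)
    (h2 : b.eval inp m.toMem = 0 → Runs inp S W d m o Q) :
    Runs inp S W (.ite b c d) m o Q := by
  by_cases hb : b.eval inp m.toMem = 0
  · obtain ⟨m', o', hd, hQ⟩ := h2 hb
    exact ⟨m', o', .ite_false hb hd, hQ⟩
  · obtain ⟨m', o', hc, hQ⟩ := h1 hb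
    exact ⟨m', o', .ite_true hb hc, hQ⟩

/-- Total correctness: `StreamExec` includes termination, so besides an invariant the rule needs a
measure `μ` that drops in every pass. -/
theorem loop {b : StreamExpr 16} {c : StreamCmd 16} (Inv : MatchMem → List (ℕ × ℕ) → Prop)
    (μ : MatchMem → ℕ) (h0 : Inv m o)
    (hstep : ∀ m o, Inv m o → b.eval inp m.toMem ≠ 0 →
      Runs inp S W c m o fun m' o' => Inv m' o' ∧ μ m' < μ m)
    (hend : ∀ m o, Inv m o → b.eval inp m.toMem = 0 → Q m o) :
    Runs inp S W (.loop b c) m o Q := by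
  induction hk : μ m using Nat.strong_induction_on generalizing m o with
  | _ k ih =>
    by_cases hb : b.eval inp m.toMem = 0
    · exact ⟨m, o, .loop_false hb, hend m o h0 hb⟩
    · obtain ⟨m', o', hc, hI, hlt⟩ := hstep m o h0 hb
      obtain ⟨m'', o'', hl, hQ⟩ := ih (μ m') (hk ▸ hlt) hI rfl
      exact ⟨m'', o'', .loop_true hb hc hl, hQ⟩

end Runs

/-! ### Exhaustive search for a maximum matching among the stored edges -/

namespace MatchProgram

/-- The content of a single cell. -/
abbrev var (a : Fin 16) : StreamExpr 16 := .cell a (.const 0)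

/-- Assignment to a single cell. -/
abbrev assign (a : Fin 16) (x : StreamExpr 16) : StreamCmd 16 := .write a (.const 0) x

/-- Whether the stored edges at positions `aux` and `pos` share an endpoint. -/
def conflict : StreamExpr 16 :=
  .add (.add (.eq (.cell 2 (var 12)) (.cell 2 (var 11))) (.eq (.cell 2 (var 12)) (.cell 3 (var 11))))
    (.add (.eq (.cell 3 (var 12)) (.cell 2 (var 11)))
      (.eq (.cell 3 (var 12)) (.cell 3 (var 11))))

/-- Compare the edge at `pos` with the selected edges before it. -/
def compareBefore : StreamCmd 16 :=
  .seq (assign 12 (.const 0))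
    (.loop (.lt (var 12) (var 11))
      (.seq (.ite (.mul (.cell 4 (var 12)) conflict) (assign 14 (.const 0)) .skip)
        (assign 12 (.add (var 12) (.const 1)))))

/-- Compute the size of the selection, and whether it is a matching. -/
def examine : StreamCmd 16 :=
  .seq (assign 14 (.const 1)) (.seq (assign 13 (.const 0)) (.seq (assign 11 (.const 0))
    (.loop (.lt (var 11) (var 7))
      (.seq (.ite (.cell 4 (var 11))
          (.seq (assign 13 (.add (var 13) (.const 1))) compareBefore) .skip)
        (assign 11 (.add (var 11) (.const 1)))))))

/-- Record the selection if it is the largest matching found so far. -/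
def record : StreamCmd 16 :=
  .ite (.mul (var 14) (.lt (var 15) (var 13)))
    (.seq (assign 15 (var 13)) (.seq (assign 11 (.const 0))
      (.loop (.lt (var 11) (var 7))
        (.seq (.write 5 (var 11) (.cell 4 (var 11)))
          (assign 11 (.add (var 11) (.const 1)))))))
    .skip

/-- Pass to the next selection, in the order of binary counting. -/
def increment : StreamCmd 16 :=
  .seq (assign 11 (.const 0))
    (.seq
      (.loop (.mul (.lt (var 11) (var 7)) (.cell 4 (var 11)))
        (.seq (.write 4 (var 11) (.const 0)) (assign 11 (.add (var 11) (.const 1)))))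
      (.ite (.lt (var 11) (var 7)) (.write 4 (var 11) (.const 1)) (assign 10 (.const 1))))

/-- Examine all selections. -/
def search : StreamCmd 16 :=
  .loop (.eq (var 10) (.const 0)) (.seq examine (.seq record increment))

/-- Output the largest matching. -/
def output : StreamCmd 16 :=
  .seq (assign 11 (.const 0))
    (.loop (.lt (var 11) (var 7))
      (.seq (.ite (.cell 5 (var 11)) (.emit (.cell 2 (var 11)) (.cell 3 (var 11))) .skip)
        (assign 11 (.add (var 11) (.const 1)))))

variable {inp : StreamInput} {S W : ℕ} {m : MatchMem} {o : List (ℕ × ℕ)}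
  {Q : MatchMem → List (ℕ × ℕ) → Prop}

theorem eval_lt_ne_zero {k : ℕ} {mem : Fin k → ℕ → ℕ} {x y : StreamExpr k} :
    (StreamExpr.lt x y).eval inp mem ≠ 0 ↔ x.eval inp mem < y.eval inp mem := by
  rw [StreamExpr.eval]
  split_ifs with h <;> simp [h]

theorem eval_lt_eq_zero {k : ℕ} {mem : Fin k → ℕ → ℕ} {x y : StreamExpr k} :
    (StreamExpr.lt x y).eval inp mem = 0 ↔ y.eval inp mem ≤ x.eval inp mem := by
  rw [← not_lt, ← eval_lt_ne_zero (inp := inp), not_ne_iff]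

theorem eval_eq_ne_zero {k : ℕ} {mem : Fin k → ℕ → ℕ} {x y : StreamExpr k} :
    (StreamExpr.eq x y).eval inp mem ≠ 0 ↔ x.eval inp mem = y.eval inp mem := by
  rw [StreamExpr.eval]
  split_ifs with h <;> simp [h]

theorem eval_mul_ne_zero {k : ℕ} {mem : Fin k → ℕ → ℕ} {x y : StreamExpr k} :
    (StreamExpr.mul x y).eval inp mem ≠ 0 ↔ x.eval inp mem ≠ 0 ∧ y.eval inp mem ≠ 0 := by
  rw [StreamExpr.eval, mul_ne_zero_iff]

theorem eval_add_ne_zero {k : ℕ} {mem : Fin k → ℕ → ℕ} {x y : StreamExpr k} :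
    (StreamExpr.add x y).eval inp mem ≠ 0 ↔ x.eval inp mem ≠ 0 ∨ y.eval inp mem ≠ 0 := by
  rw [StreamExpr.eval]
  omega

/-- The stored edges at positions `i` and `j` share an endpoint. -/
def Conflict (m : MatchMem) (i j : ℕ) : Prop :=
  m.left i = m.left j ∨ m.left i = m.right j ∨ m.right i = m.left j ∨ m.right i = m.right j

theorem eval_conflict : conflict.eval inp m.toMem ≠ 0 ↔ Conflict m m.aux m.pos := by
  unfold conflict
  simp only [eval_add_ne_zero, eval_eq_ne_zero]
  simp only [StreamExpr.eval, MatchMem.toMem_left, MatchMem.toMem_right,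
    MatchMem.toMem_aux, MatchMem.toMem_pos, singleCell_zero, Conflict, or_assoc]

/-- Like the specifications below, this is in continuation form: `Q` is arbitrary and `h` quantifies
over the final values of scratch cells, so that specifications chain through `Runs.seq`. Cells not
mentioned in the record update are thereby known to be unchanged. -/
theorem runs_compareBefore (hS : m.pos < S) (hW : m.pos < 2 ^ W)
    (h : ∀ a v, (v ≠ 0 ↔ m.ok ≠ 0 ∧ ∀ l < m.pos, m.sel l ≠ 0 → ¬Conflict m l m.pos) →
      (v = 0 ∨ v = m.ok) → Q { m with aux := a, ok := v } o) :
    Runs inp S W compareBefore m o Q := by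
  have hS0 : 0 < S := by omega
  have hW0 : 0 < 2 ^ W := by omega
  refine Runs.seq (Runs.write rfl rfl hS0 hW0 (m.update_aux 0) ?_)
  refine Runs.loop (fun m' o' => o' = o ∧ ∃ a v, m' = { m with aux := a, ok := v } ∧ a ≤ m.pos ∧
    (v ≠ 0 ↔ m.ok ≠ 0 ∧ ∀ l < a, m.sel l ≠ 0 → ¬Conflict m l m.pos) ∧ (v = 0 ∨ v = m.ok))
    (fun m' => m.pos - m'.aux) ⟨rfl, 0, m.ok, rfl, by omega, by simp, Or.inr rfl⟩ ?_ ?_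
  · rintro m' o' ⟨rfl, a, v, rfl, ha, hv, hv'⟩ hb
    have hlt : a < m.pos := eval_lt_ne_zero.1 hb
    have hbody : (StreamExpr.mul (.cell 4 (var 12)) conflict).eval inp
        ({ m with aux := a, ok := v } : MatchMem).toMem ≠ 0 ↔
          m.sel a ≠ 0 ∧ Conflict m a m.pos := by
      rw [eval_mul_ne_zero, eval_conflict]
      simp [StreamExpr.eval, Conflict]
    refine Runs.seq (Runs.ite (fun hb => ?_) fun hb => Runs.skip ?_)
    · rw [hbody] at hb
      refine Runs.write rfl rfl hS0 hW0 (MatchMem.update_ok _ 0) ?_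
      refine Runs.write (v := a + 1) rfl (by simp [StreamExpr.eval]) hS0 (by omega)
        (MatchMem.update_aux _ _) ⟨⟨rfl, a + 1, 0, rfl, hlt, ?_, Or.inl rfl⟩, ?_⟩
      · simp only [ne_eq, not_true_eq_false, false_iff, not_and, not_forall]
        exact fun _ => ⟨a, by omega, hb.1, not_not.2 hb.2⟩
      · show m.pos - (a + 1) < m.pos - a
        omega
    · have hb := not_iff_not.2 hbody |>.1 (not_not.2 hb)
      refine Runs.write (v := a + 1) rfl (by simp [StreamExpr.eval]) hS0 (by omega)
        (MatchMem.update_aux _ _) ⟨⟨rfl, a + 1, v, rfl, hlt, ?_, hv'⟩, ?_⟩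
      · rw [hv]
        refine and_congr_right fun _ => ⟨fun h l hl hs => ?_, fun h l hl => h l (by omega)⟩
        rcases Nat.lt_succ_iff_lt_or_eq.1 hl with hl | rfl
        · exact h l hl hs
        · tauto
      · show m.pos - (a + 1) < m.pos - a
        omega
  · rintro m' o' ⟨rfl, a, v, rfl, ha, hv, hv'⟩ hb
    have hge : m.pos ≤ a := eval_lt_eq_zero.1 hb
    obtain rfl : a = m.pos := by omega
    exact h _ _ hv hv'

/-- The positions that are marked by an array. -/
def marked (L : ℕ) (f : ℕ → ℕ) : Finset ℕ := (Finset.range L).filter fun j => f j ≠ 0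

theorem mem_marked {L : ℕ} {f : ℕ → ℕ} {j : ℕ} : j ∈ marked L f ↔ j < L ∧ f j ≠ 0 := by
  simp [marked]

theorem marked_succ (L : ℕ) (f : ℕ → ℕ) :
    marked (L + 1) f = if f L ≠ 0 then insert L (marked L f) else marked L f := by
  rw [marked, Finset.range_add_one, Finset.filter_insert]
  rfl

/-- The edges at the positions in `B` are pairwise disjoint. -/
def Valid (m : MatchMem) (B : Finset ℕ) : Prop := ∀ l ∈ B, ∀ j ∈ B, l < j → ¬Conflict m l j

theorem runs_examine (hS : m.len < S) (hW : m.len + 1 < 2 ^ W)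
    (h : ∀ p a v, (v ≠ 0 ↔ Valid m (marked m.len m.sel)) →
      Q { m with pos := p, aux := a, ok := v, size := (marked m.len m.sel).card } o) :
    Runs inp S W examine m o Q := by
  have hS0 : 0 < S := by omega
  have hW0 : 0 < 2 ^ W := by omega
  refine Runs.seq (Runs.write (v := 1) rfl rfl hS0 (by omega) (m.update_ok 1) ?_)
  refine Runs.seq (Runs.write (v := 0) rfl rfl hS0 hW0 (MatchMem.update_size _ 0) ?_)
  refine Runs.seq (Runs.write (v := 0) rfl rfl hS0 hW0 (MatchMem.update_pos _ 0) ?_)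
  refine Runs.loop (fun m' o' => o' = o ∧ ∃ p a v, m' = { m with
      pos := p, aux := a, ok := v, size := (marked p m.sel).card } ∧ p ≤ m.len ∧
    (v ≠ 0 ↔ Valid m (marked p m.sel)))
    (fun m' => m.len - m'.pos) ⟨rfl, 0, m.aux, 1, rfl, by omega, by simp [Valid, marked]⟩ ?_ ?_
  · rintro m' o' ⟨rfl, p, a, v, rfl, hp, hv⟩ hb
    have hlt : p < m.len := eval_lt_ne_zero.1 hb
    have hcard : (marked p m.sel).card ≤ p := (Finset.card_filter_le _ _).trans (by simp)
    have hnot : p ∉ marked p m.sel := by simp [mem_marked]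
    have hsucc := marked_succ p m.sel
    refine Runs.seq (Runs.ite (fun hb => ?_) fun hb => Runs.skip ?_)
    · have hb : m.sel p ≠ 0 := by simpa [StreamExpr.eval] using hb
      rw [if_pos hb] at hsucc
      refine Runs.seq (Runs.write (v := (marked p m.sel).card + 1) rfl
        (by simp [StreamExpr.eval]) hS0 (by omega) (MatchMem.update_size _ _) ?_)
      refine runs_compareBefore (by simpa using hlt.trans hS)
        (by show p < 2 ^ W; omega) fun a' v' hv' _ => ?_
      refine Runs.write (v := p + 1) rfl (by simp [StreamExpr.eval]) hS0 (by omega)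
        (MatchMem.update_pos _ _) ⟨⟨rfl, p + 1, a', v', ?_, hlt, ?_⟩, ?_⟩
      · rw [hsucc, Finset.card_insert_of_notMem hnot]
      · rw [hv', hv, hsucc]
        have hc : ∀ l j, Conflict { m with
            size := (marked p m.sel).card + 1, pos := p, aux := a, ok := v } l j ↔
            Conflict m l j := fun _ _ => Iff.rfl
        simp only [hc]
        constructor
        · rintro ⟨h1, h2⟩ l hl j hj hlj
          rcases Finset.mem_insert.1 hl with rfl | hl <;>
            rcases Finset.mem_insert.1 hj with rfl | hj
          · omega
          · have := (mem_marked.1 hj).1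
            omega
          · exact h2 l (mem_marked.1 hl).1 (mem_marked.1 hl).2
          · exact h1 l hl j hj hlj
        · intro h1
          exact ⟨fun l hl j hj => h1 l (Finset.mem_insert_of_mem hl) j
            (Finset.mem_insert_of_mem hj), fun l hl hs => h1 l
            (Finset.mem_insert_of_mem (mem_marked.2 ⟨hl, hs⟩)) p (Finset.mem_insert_self _ _) hl⟩
      · show m.len - (p + 1) < m.len - p
        omega
    · have hb : m.sel p = 0 := by simpa [StreamExpr.eval] using hb
      rw [if_neg (not_not.2 hb)] at hsucc
      refine Runs.write (v := p + 1) rfl (by simp [StreamExpr.eval]) hS0 (by omega)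
        (MatchMem.update_pos _ _) ⟨⟨rfl, p + 1, a, v, ?_, hlt, ?_⟩, ?_⟩
      · rw [hsucc]
      · rw [hv, hsucc]
      · show m.len - (p + 1) < m.len - p
        omega
  · rintro m' o' ⟨rfl, p, a, v, rfl, hp, hv⟩ hb
    have hge : m.len ≤ p := eval_lt_eq_zero.1 hb
    obtain rfl : p = m.len := by omega
    exact h _ _ _ hv

theorem runs_record (hS : m.len < S) (hW : m.len + 1 < 2 ^ W)
    (hsize : m.size ≤ m.len) (hsel : ∀ j, m.sel j < 2 ^ W)
    (h1 : m.ok ≠ 0 → m.top < m.size → ∀ p b, (∀ j < m.len, b j = m.sel j) →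
      Q { m with pos := p, top := m.size, best := b } o)
    (h2 : (m.ok ≠ 0 → m.size ≤ m.top) → Q m o) :
    Runs inp S W record m o Q := by
  have hS0 : 0 < S := by omega
  have hW0 : 0 < 2 ^ W := by omega
  refine Runs.ite (fun hb => ?_) fun hb => Runs.skip (h2 fun hok => ?_)
  · rw [eval_mul_ne_zero, eval_lt_ne_zero] at hb
    simp only [StreamExpr.eval, MatchMem.toMem_ok, MatchMem.toMem_top, MatchMem.toMem_size,
      singleCell_zero] at hb
    refine Runs.seq (Runs.write (v := m.size) rfl (by simp [StreamExpr.eval]) hS0 (by omega)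
      (m.update_top _) ?_)
    refine Runs.seq (Runs.write (v := 0) rfl rfl hS0 hW0 (MatchMem.update_pos _ 0) ?_)
    refine Runs.loop (fun m' o' => o' = o ∧ ∃ p b, m' = { m with
        pos := p, top := m.size, best := b } ∧ p ≤ m.len ∧ ∀ j < p, b j = m.sel j)
      (fun m' => m.len - m'.pos) ⟨rfl, 0, m.best, rfl, by omega, by simp⟩ ?_ ?_
    · rintro m' o' ⟨rfl, p, b, rfl, hp, hbs⟩ hb'
      have hlt : p < m.len := eval_lt_ne_zero.1 hb'
      refine Runs.seq (Runs.write (p := p) (v := m.sel p) (by simp [StreamExpr.eval])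
        (by simp [StreamExpr.eval]) (by omega) (hsel p) (MatchMem.update_best _ _ _) ?_)
      refine Runs.write (v := p + 1) rfl (by simp [StreamExpr.eval]) hS0 (by omega)
        (MatchMem.update_pos _ _) ⟨⟨rfl, p + 1, _, rfl, hlt, fun j hj => ?_⟩, ?_⟩
      · rcases Nat.lt_succ_iff_lt_or_eq.1 hj with hj | rfl
        · simp [Function.update_of_ne hj.ne, hbs j hj]
        · simp
      · show m.len - (p + 1) < m.len - p
        omega
    · rintro m' o' ⟨rfl, p, b, rfl, hp, hbs⟩ hb'
      have hge : m.len ≤ p := eval_lt_eq_zero.1 hb'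
      obtain rfl : p = m.len := by omega
      exact h1 hb.1 hb.2 _ _ hbs
  · by_contra hc
    refine absurd hb (eval_mul_ne_zero.2 ⟨?_, eval_lt_ne_zero.2 ?_⟩)
    · simpa [StreamExpr.eval] using hok
    · simpa [StreamExpr.eval] using hc

/-- The carry clears the initial block of ones. It either stops at a zero, which becomes a one, or
overflows, which means that all selections have been seen and sets `halt`. -/
theorem runs_increment (hS : m.len < S) (hW : m.len + 1 < 2 ^ W)
    (h1 : ∀ p < m.len, (∀ j < p, m.sel j ≠ 0) → m.sel p = 0 →
      Q { m with pos := p, sel := Function.update (fun j => if j < p then 0 else m.sel j) p 1 } o)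
    (h2 : (∀ j < m.len, m.sel j ≠ 0) →
      Q { m with pos := m.len, halt := 1, sel := fun j => if j < m.len then 0 else m.sel j } o) :
    Runs inp S W increment m o Q := by
  have hS0 : 0 < S := by omega
  have hW0 : 0 < 2 ^ W := by omega
  refine Runs.seq (Runs.write (v := 0) rfl rfl hS0 hW0 (MatchMem.update_pos _ 0) ?_)
  refine Runs.seq (Runs.loop (fun m' o' => o' = o ∧ ∃ p, m' = { m with
      pos := p, sel := fun j => if j < p then 0 else m.sel j } ∧ p ≤ m.len ∧
      ∀ j < p, m.sel j ≠ 0) (fun m' => m.len - m'.pos)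
      ⟨rfl, 0, by simp, by omega, by simp⟩ ?_ ?_)
  · rintro m' o' ⟨rfl, p, rfl, hp, hs⟩ hb
    rw [eval_mul_ne_zero, eval_lt_ne_zero] at hb
    simp only [StreamExpr.eval, MatchMem.toMem_pos, MatchMem.toMem_len, MatchMem.toMem_sel,
      singleCell_zero, lt_irrefl, if_false] at hb
    obtain ⟨hlt, hsp⟩ := hb
    refine Runs.seq (Runs.write (p := p) (v := 0) (by simp [StreamExpr.eval])
      (by simp [StreamExpr.eval]) (by omega) hW0 (MatchMem.update_sel _ _ _) ?_)
    refine Runs.write (v := p + 1) rfl (by simp [StreamExpr.eval]) hS0 (by omega)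
      (MatchMem.update_pos _ _) ⟨⟨rfl, p + 1, ?_, hlt, fun j hj => ?_⟩, ?_⟩
    · congr 1
      funext j
      by_cases hj : j = p
      · subst hj; simp
      · show Function.update (fun j => if j < p then 0 else m.sel j) p 0 j = _
        rw [Function.update_of_ne hj]
        have : j < p + 1 ↔ j < p := by omega
        simp only [this]
    · rcases Nat.lt_succ_iff_lt_or_eq.1 hj with hj | rfl
      · exact hs j hj
      · exact hsp
    · show m.len - (p + 1) < m.len - p
      omega
  · rintro m' o' ⟨rfl, p, rfl, hp, hs⟩ hb
    rcases Nat.lt_or_ge p m.len with hlt | hge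
    · have hsp : m.sel p = 0 := by
        by_contra hc
        refine absurd hb (eval_mul_ne_zero.2 ⟨eval_lt_ne_zero.2 ?_, ?_⟩)
        · simpa [StreamExpr.eval] using hlt
        · simpa [StreamExpr.eval] using hc
      refine Runs.ite (fun _ => ?_) fun hb => ?_
      · exact Runs.write (p := p) (v := 1) (by simp [StreamExpr.eval]) rfl (by omega)
          (by omega) (MatchMem.update_sel _ _ _) (h1 p hlt hs hsp)
      · have := eval_lt_eq_zero.1 hb
        simp [StreamExpr.eval] at this
        omega
    · obtain rfl : p = m.len := by omega
      refine Runs.ite (fun hb => ?_) fun hb => ?_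
      · have := eval_lt_ne_zero.1 hb
        simp [StreamExpr.eval] at this
      · exact Runs.write (v := 1) rfl rfl hS0 (by omega) (MatchMem.update_halt _ _) (h2 hs)

end MatchProgram

/-! ### Enumeration of all selections by binary counting -/

namespace MatchProgram

variable {inp : StreamInput} {S W : ℕ} {m : MatchMem} {o : List (ℕ × ℕ)}
  {Q : MatchMem → List (ℕ × ℕ) → Prop}

/-- The number whose binary digits are given by `B`. -/
def binaryValue (B : Finset ℕ) : ℕ := ∑ j ∈ B, 2 ^ j

theorem binaryValue_injective : Function.Injective binaryValue :=
  Finset.geomSum_injective le_rfl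

theorem binaryValue_range (L : ℕ) : binaryValue (Finset.range L) + 1 = 2 ^ L := by
  induction L with
  | zero => rfl
  | succ L ih =>
    rw [binaryValue, Finset.sum_range_succ, ← binaryValue, pow_succ]
    omega

theorem binaryValue_le {L : ℕ} {B : Finset ℕ} (hB : B ⊆ Finset.range L) :
    binaryValue B ≤ binaryValue (Finset.range L) :=
  Finset.sum_le_sum_of_subset hB

theorem marked_subset_range (L : ℕ) (f : ℕ → ℕ) : marked L f ⊆ Finset.range L :=
  Finset.filter_subset _ _

/-- The digits above `p` form the common part `R`; below it, `1 + 2 + ⋯ + 2 ^ (p - 1)` is replaced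
by `2 ^ p`. -/
theorem binaryValue_increment {L p : ℕ} {f : ℕ → ℕ} (hp : p < L) (h1 : ∀ j < p, f j ≠ 0)
    (h0 : f p = 0) :
    binaryValue (marked L (Function.update (fun j => if j < p then 0 else f j) p 1)) =
      binaryValue (marked L f) + 1 := by
  set R := (Finset.range L).filter fun j => p < j ∧ f j ≠ 0 with hR
  have e1 : marked L f = Finset.range p ∪ R := by
    ext j
    simp only [mem_marked, hR, Finset.mem_union, Finset.mem_filter, Finset.mem_range]
    rcases lt_trichotomy j p with h | h | h
    · have := h1 j h
      constructor
      · exact fun _ => Or.inl h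
      · exact fun _ => ⟨by omega, this⟩
    · subst h; simp [h0]
    · constructor
      · exact fun h' => Or.inr ⟨h'.1, h, h'.2⟩
      · rintro (h' | h')
        · omega
        · exact ⟨h'.1, h'.2.2⟩
  have e2 : marked L (Function.update (fun j => if j < p then 0 else f j) p 1) =
      insert p R := by
    ext j
    simp only [mem_marked, hR, Finset.mem_insert, Finset.mem_filter, Finset.mem_range]
    rcases lt_trichotomy j p with h | h | h
    · rw [Function.update_of_ne h.ne]
      simp [h, h.ne, h.not_gt]
    · subst h; simp [hp]
    · rw [Function.update_of_ne h.ne']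
      simp [h, h.ne', h.not_gt]
  have hd : Disjoint (Finset.range p) R := by
    rw [Finset.disjoint_left]
    intro j hj hj'
    have := (Finset.mem_filter.1 hj').2.1
    have := Finset.mem_range.1 hj
    omega
  have hpR : p ∉ R := by simp [hR]
  have := binaryValue_range p
  rw [e1, e2, binaryValue, binaryValue, Finset.sum_union hd, Finset.sum_insert hpR]
  unfold binaryValue at this
  omega

/-- The invariant says that `best` is valid and at least as large as every valid selection of
smaller binary value, without restriction on that value once `halt` is set. Initially the selection
is empty and nothing precedes it. -/
theorem runs_search (hS : m.len < S) (hW : m.len + 1 < 2 ^ W) (hhalt : m.halt = 0)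
    (htop : m.top = 0) (hsel : ∀ j, m.sel j = 0) (hbest : ∀ j, m.best j = 0)
    (h : ∀ s b p a z k t h, Valid m (marked m.len b) →
      (∀ B ⊆ Finset.range m.len, Valid m B → B.card ≤ (marked m.len b).card) →
      Q { m with sel := s, best := b, pos := p, aux := a, size := z, ok := k, top := t,
                 halt := h } o) :
    Runs inp S W search m o Q := by
  have hempty : ∀ f : ℕ → ℕ, (∀ j, f j = 0) → marked m.len f = ∅ := by
    intro f hf
    ext j
    simp [mem_marked, hf]
  refine Runs.loop (fun m' o' => o' = o ∧ ∃ s b p a z k t h, m' = { m with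
      sel := s, best := b, pos := p, aux := a, size := z, ok := k, top := t, halt := h } ∧
      (∀ j, s j ≤ 1) ∧ Valid m (marked m.len b) ∧ t = (marked m.len b).card ∧
      ∀ B ⊆ Finset.range m.len, Valid m B →
        (h = 0 → binaryValue B < binaryValue (marked m.len s)) → B.card ≤ t)
    (fun m' => if m'.halt = 0 then 2 ^ m.len - binaryValue (marked m.len m'.sel) else 0)
    ⟨rfl, _, _, _, _, _, _, _, _, rfl, by simp [hsel], ?_, ?_, ?_⟩ ?_ ?_
  · simp [hempty _ hbest, Valid]
  · simp [hempty _ hbest, htop]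
  · intro B hB hBv hlt
    have := hlt hhalt
    rw [hempty _ hsel] at this
    simp [binaryValue] at this
  · rintro m' o' ⟨rfl, s, b, p, a, z, k, t, h, rfl, hs, hb, ht, hB⟩ hh
    have hh : h = 0 := eval_eq_ne_zero.1 hh
    subst hh
    have hlt : binaryValue (marked m.len s) < 2 ^ m.len := by
      have := binaryValue_range m.len
      have := binaryValue_le (marked_subset_range m.len s)
      omega
    have hincr : ∀ b p a z k t, Valid m (marked m.len b) → t = (marked m.len b).card →
        (∀ B ⊆ Finset.range m.len, Valid m B →
          binaryValue B ≤ binaryValue (marked m.len s) → B.card ≤ t) →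
        Runs inp S W increment { m with
          sel := s, best := b, pos := p, aux := a, size := z, ok := k, top := t, halt := 0 } o'
          fun m' o'' => (o'' = o' ∧ ∃ s b p a z k t h, m' = { m with
            sel := s, best := b, pos := p, aux := a, size := z, ok := k, top := t, halt := h } ∧
            (∀ j, s j ≤ 1) ∧ Valid m (marked m.len b) ∧ t = (marked m.len b).card ∧
            ∀ B ⊆ Finset.range m.len, Valid m B →
              (h = 0 → binaryValue B < binaryValue (marked m.len s)) → B.card ≤ t) ∧
          (if m'.halt = 0 then 2 ^ m.len - binaryValue (marked m.len m'.sel) else 0) <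
            2 ^ m.len - binaryValue (marked m.len s) := by
      intro b p a z k t hb ht hB
      refine runs_increment (by exact hS) (by exact hW) ?_ ?_
      · intro q hq h1 h0
        have hv := binaryValue_increment (L := m.len) hq h1 h0
        refine ⟨⟨rfl, _, _, _, _, _, _, _, _, rfl, ?_, hb, ht, ?_⟩, ?_⟩
        · intro j
          by_cases hj : j = q
          · subst hj; simp
          · rw [Function.update_of_ne hj]
            split_ifs
            · omega
            · exact hs j
        · intro B hBs hBv hlt'
          refine hB B hBs hBv (Nat.lt_succ_iff.1 ?_)
          rw [Nat.succ_eq_add_one, ← hv]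
          exact hlt' rfl
        · show (if (0 : ℕ) = 0 then 2 ^ m.len - binaryValue (marked m.len _) else 0) < _
          rw [if_pos rfl, hv]
          show 2 ^ m.len - (binaryValue (marked m.len s) + 1) < _
          omega
      · intro h1
        refine ⟨⟨rfl, _, _, _, _, _, _, _, _, rfl, ?_, hb, ht, ?_⟩, ?_⟩
        · intro j
          show (if j < m.len then 0 else s j) ≤ 1
          split_ifs
          · omega
          · exact hs j
        · intro B hBs hBv _
          refine hB B hBs hBv ?_
          have : marked m.len s = Finset.range m.len := by
            ext j
            rw [mem_marked, Finset.mem_range]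
            exact ⟨fun h => h.1, fun h => ⟨h, h1 j h⟩⟩
          rw [this]
          exact binaryValue_le hBs
        · show (if (1 : ℕ) = 0 then 2 ^ m.len - binaryValue (marked m.len _) else 0) < _
          rw [if_neg one_ne_zero]
          omega
    have hsize : (marked m.len s).card ≤ m.len := (Finset.card_filter_le _ _).trans (by simp)
    refine Runs.seq (runs_examine (by exact hS) (by exact hW) fun q a' v hv => ?_)
    have hv : v ≠ 0 ↔ Valid m (marked m.len s) := hv
    refine Runs.seq (runs_record (by exact hS) (by exact hW) (by exact hsize)
      (fun j => (hs j).trans_lt (by omega)) ?_ ?_)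
    · intro hok hlt' q' b' hb'
      have hlt' : t < (marked m.len s).card := hlt'
      have hmb : marked m.len b' = marked m.len s := by
        ext j
        simp only [mem_marked]
        refine and_congr_right fun hj => ?_
        rw [hb' j hj]
      refine hincr b' _ _ _ _ _ ?_ ?_ ?_
      · rw [hmb]; exact hv.1 hok
      · show (marked m.len s).card = _
        rw [hmb]
      · intro B hBs hBv hBle
        show B.card ≤ (marked m.len s).card
        rcases hBle.lt_or_eq with hBlt | hBeq
        · exact (hB B hBs hBv fun _ => hBlt).trans hlt'.le
        -- A selection that is not strictly earlier in the count is the current one.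
        · rw [binaryValue_injective hBeq]
    · intro hle
      have hle : v ≠ 0 → (marked m.len s).card ≤ t := hle
      refine hincr b _ _ _ _ _ hb ht ?_
      intro B hBs hBv hBle
      rcases hBle.lt_or_eq with hBlt | hBeq
      · exact hB B hBs hBv fun _ => hBlt
      · have := binaryValue_injective hBeq
        subst this
        exact hle (hv.2 hBv)
  · rintro m' o' ⟨rfl, s, b, p, a, z, k, t, h', rfl, hs, hb, ht, hB⟩ hh
    have hh : h' ≠ 0 := by
      intro h0
      exact (eval_eq_ne_zero (inp := inp) (x := var 10) (y := .const 0)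
        (mem := MatchMem.toMem { m with
          sel := s, best := b, pos := p, aux := a, size := z, ok := k, top := t, halt := h' })).2
        h0 hh
    refine h _ _ _ _ _ _ _ _ hb fun B hBs hBv => ?_
    rw [← ht]
    exact hB B hBs hBv fun h0 => (hh h0).elim

theorem runs_output (hS : m.len < S) (hW : m.len + 1 < 2 ^ W)
    (h : ∀ p, Q { m with pos := p } (o ++ ((List.range m.len).filter fun j => m.best j ≠ 0).map
      fun j => (m.left j, m.right j))) :
    Runs inp S W output m o Q := by
  have hS0 : 0 < S := by omega
  have hW0 : 0 < 2 ^ W := by omega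
  refine Runs.seq (Runs.write (v := 0) rfl rfl hS0 hW0 (MatchMem.update_pos _ 0) ?_)
  refine Runs.loop (fun m' o' => ∃ p, m' = { m with pos := p } ∧ p ≤ m.len ∧
      o' = o ++ ((List.range p).filter fun j => m.best j ≠ 0).map
        fun j => (m.left j, m.right j)) (fun m' => m.len - m'.pos)
      ⟨0, rfl, by omega, by simp⟩ ?_ ?_
  · rintro m' o' ⟨p, rfl, hp, rfl⟩ hb
    have hlt : p < m.len := eval_lt_ne_zero.1 hb
    refine Runs.seq (Runs.ite (fun hb => Runs.emit ?_) fun hb => Runs.skip ?_)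
    · have hb : m.best p ≠ 0 := hb
      refine Runs.write (v := p + 1) rfl (by simp [StreamExpr.eval]) hS0 (by omega)
        (MatchMem.update_pos _ _) ⟨⟨p + 1, rfl, hlt, ?_⟩, ?_⟩
      · rw [List.range_succ, List.filter_append, List.map_append, List.append_assoc]
        simp [hb, StreamExpr.eval]
      · show m.len - (p + 1) < m.len - p
        omega
    · have hb : m.best p = 0 := hb
      refine Runs.write (v := p + 1) rfl (by simp [StreamExpr.eval]) hS0 (by omega)
        (MatchMem.update_pos _ _) ⟨⟨p + 1, rfl, hlt, ?_⟩, ?_⟩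
      · rw [List.range_succ, List.filter_append, List.map_append]
        simp [hb]
      · show m.len - (p + 1) < m.len - p
        omega
  · rintro m' o' ⟨p, rfl, hp, rfl⟩ hb
    have hge : m.len ≤ p := eval_lt_eq_zero.1 hb
    obtain rfl : p = m.len := by omega
    exact h _

end MatchProgram

namespace MatchProgram

/-! ### Thresholds -/

/-- The sizes of the greedy matching at which the program starts to collect edges. -/
def threshold : ℕ → ℕ
  | 0 => 0
  | i + 1 => threshold i + threshold i / 100 + 1

theorem threshold_strictMono : StrictMono threshold :=
  strictMono_nat_of_lt_succ fun i => by rw [threshold]; omega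

theorem exists_lt_threshold (n : ℕ) : ∃ i, n < threshold i :=
  ⟨n + 1, (threshold_strictMono.le_apply (x := n + 1)).trans_lt' (Nat.lt_succ_self n)⟩

/-- The number of thresholds that are at most `n`. -/
def numThresholds (n : ℕ) : ℕ := Nat.find (exists_lt_threshold n)

theorem threshold_le_iff {n i : ℕ} : threshold i ≤ n ↔ i < numThresholds n := by
  constructor
  · intro h
    by_contra hc
    have h1 := Nat.find_spec (exists_lt_threshold n)
    have h2 := threshold_strictMono.monotone (not_lt.1 hc)
    unfold numThresholds at h2
    omega
  · exact fun h => not_lt.1 (Nat.find_min (exists_lt_threshold n) h)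

theorem numThresholds_le (n : ℕ) : numThresholds n ≤ n + 1 := by
  by_contra hc
  have h1 := threshold_le_iff.2 (not_le.1 hc)
  have h2 := threshold_strictMono.le_apply (x := n + 1)
  omega

/-- Each of the 100 steps adds at least a hundredth of `threshold i`, the summand 1 making up for
the rounding. Consequently the number of thresholds up to `n` is logarithmic. -/
theorem two_mul_threshold_le (i : ℕ) : 2 * threshold i ≤ threshold (i + 100) := by
  have h : ∀ k, k * threshold i ≤ 100 * (threshold (i + k) - threshold i) := by
    intro k
    induction k with
    | zero => simp
    | succ k ih =>
      have h1 := threshold_strictMono.monotone (Nat.le_add_right i k)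
      rw [← add_assoc, threshold, add_mul]
      omega
  have := h 100
  omega

theorem two_pow_le_threshold (k : ℕ) : 2 ^ k ≤ threshold (100 * k + 1) := by
  induction k with
  | zero => simp [threshold]
  | succ k ih =>
    have := two_mul_threshold_le (100 * k + 1)
    rw [pow_succ]
    rw [show 100 * (k + 1) + 1 = 100 * k + 1 + 100 by ring]
    omega

theorem numThresholds_le_log (n : ℕ) : numThresholds n ≤ 100 * (Nat.log 2 n + 1) + 1 := by
  by_contra hc
  have h1 := threshold_le_iff.2 (not_le.1 hc)
  have h2 := two_pow_le_threshold (Nat.log 2 n + 1)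
  have h3 := Nat.lt_pow_succ_log_self (b := 2) (by norm_num) n
  rw [Nat.succ_eq_add_one] at h3
  omega

/-- Some threshold is slightly smaller than `N / 2`. -/
theorem exists_threshold (N : ℕ) :
    ∃ i, 200 * threshold i ≤ 99 * N + 200 ∧ 49 * N ≤ 100 * threshold i := by
  -- The predecessor of the first threshold above `0.495 * N + 1` is suitable: consecutive
  -- thresholds differ by a factor `1.01` and a summand 1, and `0.495 / 1.01 > 0.49`.
  have hex : ∃ i, 99 * N + 200 < 200 * threshold i := by
    obtain ⟨i, hi⟩ := exists_lt_threshold (99 * N + 200)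
    exact ⟨i, by omega⟩
  have h1 := Nat.find_spec hex
  have h0 : Nat.find hex ≠ 0 := by
    intro h
    rw [h, threshold] at h1
    omega
  obtain ⟨i, hi⟩ := Nat.exists_eq_succ_of_ne_zero h0
  have h2 := Nat.find_min hex (m := i) (by omega)
  rw [hi, Nat.succ_eq_add_one, threshold] at h1
  exact ⟨i, by omega, by omega⟩

/-! ### Processing an edge -/

/-- Store the current edge. -/
def append : StreamCmd 16 :=
  .seq (.write 2 (var 7) .fst) (.seq (.write 3 (var 7) .snd) (assign 7 (.add (var 7) (.const 1))))

/-- Whether a vertex is covered by the first `thr` greedy edges. -/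
def covered (x : StreamExpr 16) : StreamExpr 16 :=
  .mul (.lt (.const 0) (.cell 0 x)) (.lt (.cell 0 x) (.add (var 9) (.const 1)))

/-- The address of the degree of a vertex for the current threshold. -/
def degAddr (x : StreamExpr 16) : StreamExpr 16 := .add (.mul (var 8) .numVertices) x

/-- Whether the degree of a vertex may grow. -/
def hasRoom (x : StreamExpr 16) : StreamExpr 16 :=
  .lt (.cell 1 (degAddr x)) (.sub (.const 8) (.mul (.const 6) (covered x)))

/-- Whether the current edge is to be kept for the current threshold. -/
def keepTest : StreamExpr 16 :=
  .mul (.lt (var 9) (.add (var 6) (.const 1)))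
    (.mul (.eq (.eq (covered .fst) (covered .snd)) (.const 0))
      (.mul (hasRoom .fst) (hasRoom .snd)))

/-- Keep the current edge for the current threshold, if possible. -/
def keep : StreamCmd 16 :=
  .ite keepTest
    (.seq (.write 1 (degAddr .fst) (.add (.cell 1 (degAddr .fst)) (.const 1)))
      (.seq (.write 1 (degAddr .snd) (.add (.cell 1 (degAddr .snd)) (.const 1))) append))
    .skip

/-- Treat the current edge for all thresholds. -/
def keepAll : StreamCmd 16 :=
  .seq (assign 8 (.const 0)) (.seq (assign 9 (.const 0))
    (.loop (.lt (var 9) (.add .numVertices (.const 1)))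
      (.seq keep
        (.seq (assign 9 (.add (.add (var 9) (.div (var 9) (.const 100))) (.const 1)))
          (assign 8 (.add (var 8) (.const 1)))))))

/-- One step of the greedy algorithm. -/
def extendGreedy : StreamCmd 16 :=
  .ite (.add (.cell 0 .fst) (.cell 0 .snd)) .skip
    (.seq (assign 6 (.add (var 6) (.const 1)))
      (.seq (.write 0 .fst (var 6)) (.seq (.write 0 .snd (var 6)) append)))

/-- Process the current edge. -/
def process : StreamCmd 16 := .seq keepAll extendGreedy

variable {n : ℕ} {S W : ℕ} {m : MatchMem} {o : List (ℕ × ℕ)}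
  {Q : MatchMem → List (ℕ × ℕ) → Prop}

/-- Two arrays hold the endpoints of the edges of a list. -/
def Stores (left right : ℕ → ℕ) (H : List (Fin n × Fin n)) : Prop :=
  ∀ j (hj : j < H.length), left j = H[j].1 ∧ right j = H[j].2

theorem Stores.snoc {left right : ℕ → ℕ} {H : List (Fin n × Fin n)} (h : Stores left right H)
    (e : Fin n × Fin n) :
    Stores (Function.update left H.length e.1) (Function.update right H.length e.2)
      (H ++ [e]) := by
  intro j hj
  rw [List.length_append, List.length_singleton] at hj
  rcases Nat.lt_succ_iff_lt_or_eq.1 hj with hj | rfl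
  · rw [Function.update_of_ne hj.ne, Function.update_of_ne hj.ne, List.getElem_append_left hj]
    exact h j hj
  · simp

theorem runs_append {e : Fin n × Fin n} {H : List (Fin n × Fin n)} (hlen : m.len = H.length)
    (hH : Stores m.left m.right H) (hS : H.length < S) (hW : H.length + 1 < 2 ^ W)
    (hn : n < 2 ^ W)
    (h : ∀ l r, Stores l r (H ++ [e]) →
      Q { m with left := l, right := r, len := (H ++ [e]).length } o) :
    Runs ⟨n, e.1, e.2⟩ S W append m o Q := by
  have h1 := e.1.2
  have h2 := e.2.2
  refine Runs.seq (Runs.write (p := H.length) (v := e.1) hlen rfl (by omega) (by omega)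
    (MatchMem.update_left _ _ _) ?_)
  refine Runs.seq (Runs.write (p := H.length) (v := e.2) hlen rfl (by omega) (by omega)
    (MatchMem.update_right _ _ _) ?_)
  refine Runs.write (p := 0) (v := (H ++ [e]).length) rfl ?_ (by omega)
    (by rw [List.length_append, List.length_singleton]; omega) (MatchMem.update_len _ _)
    (h _ _ (hH.snoc e))
  rw [List.length_append, List.length_singleton, ← hlen]
  rfl

/-- The array `ord` records when the vertices are covered by `M`. -/
def OrdSpec (ord : ℕ → ℕ) (M : List (Fin n × Fin n)) : Prop :=
  ∀ (v : Fin n) (τ : ℕ), (0 < ord v ∧ ord v ≤ τ) ↔ v ∈ coveredVertices (M.take τ)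

theorem OrdSpec.pos_iff {ord : ℕ → ℕ} {M : List (Fin n × Fin n)} (h : OrdSpec ord M)
    (v : Fin n) : 0 < ord v ↔ v ∈ coveredVertices M := by
  have h1 := h v (ord v + M.length)
  rw [List.take_of_length_le (by omega)] at h1
  rw [← h1]
  omega

theorem OrdSpec.le_length {ord : ℕ → ℕ} {M : List (Fin n × Fin n)} (h : OrdSpec ord M)
    (v : Fin n) : ord v ≤ M.length := by
  by_contra hc
  have h1 := (h.pos_iff v).1 (by omega)
  have h2 := h v M.length
  rw [List.take_of_length_le le_rfl] at h2
  have := h2.2 h1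
  omega

/-- The new vertices get the time stamp `M.length + 1`, which is invisible to every `τ ≤ M.length`.
Thus one array of time stamps describes the sets `U` for all thresholds at once. -/
theorem OrdSpec.snoc {ord : ℕ → ℕ} {M : List (Fin n × Fin n)} (h : OrdSpec ord M)
    {e : Fin n × Fin n} (h1 : e.1 ∉ coveredVertices M) (h2 : e.2 ∉ coveredVertices M) :
    OrdSpec (Function.update (Function.update ord e.1 (M.length + 1)) e.2 (M.length + 1))
      (M ++ [e]) := by
  intro v τ
  rcases le_or_gt τ M.length with hτ | hτ
  · rw [List.take_append_of_le_length hτ, ← h]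
    by_cases hv : v = e.1 ∨ v = e.2
    · have h0 : ¬0 < ord v := by
        rw [h.pos_iff]
        rcases hv with rfl | rfl <;> assumption
      have hu : Function.update (Function.update ord e.1 (M.length + 1)) e.2 (M.length + 1) v =
          M.length + 1 := by
        rcases hv with rfl | rfl
        · by_cases he : (e.1 : ℕ) = e.2
          · rw [he]; simp
          · rw [Function.update_of_ne he]; simp
        · simp
      rw [hu]
      omega
    · push Not at hv
      rw [Function.update_of_ne (fun h => hv.2 (Fin.ext h)),
        Function.update_of_ne (fun h => hv.1 (Fin.ext h))]
  · rw [List.take_of_length_le (by simpa using hτ), coveredVertices_append]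
    simp only [Finset.mem_insert]
    by_cases hv2 : v = e.2
    · subst hv2
      simp only [Function.update_self, or_true, true_or, iff_true]
      omega
    · rw [Function.update_of_ne (fun h => hv2 (Fin.ext h))]
      by_cases hv1 : v = e.1
      · subst hv1
        simp only [Function.update_self, true_or, iff_true]
        omega
      · rw [Function.update_of_ne (fun h => hv1 (Fin.ext h)), ← h.pos_iff]
        have := h.le_length v
        simp only [hv1, hv2, false_or]
        omega

theorem eval_covered {inp : StreamInput} {M : List (Fin n × Fin n)} (hord : OrdSpec m.ord M)
    {x : StreamExpr 16} {v : Fin n} (hx : x.eval inp m.toMem = v) :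
    (covered x).eval inp m.toMem = if v ∈ coveredVertices (M.take m.thr) then 1 else 0 := by
  have h : (covered x).eval inp m.toMem =
      (if 0 < m.ord v then 1 else 0) * (if m.ord v < m.thr + 1 then 1 else 0) := by
    rw [← hx]
    rfl
  rw [h]
  have := hord v m.thr
  by_cases hc : v ∈ coveredVertices (M.take m.thr)
  · have := this.2 hc
    rw [if_pos hc, if_pos this.1, if_pos (by omega)]
  · rw [if_neg hc]
    have h' := not_iff_not.2 this |>.2 hc
    by_cases h0 : 0 < m.ord v
    · rw [if_neg (by omega : ¬m.ord v < m.thr + 1), mul_zero]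
    · rw [if_neg h0, zero_mul]

theorem eval_hasRoom {inp : StreamInput} {M F : List (Fin n × Fin n)} (hord : OrdSpec m.ord M)
    (hn : inp.numVertices = n) {x : StreamExpr 16} {v : Fin n} (hx : x.eval inp m.toMem = v)
    (hdeg : m.deg (m.idx * n + v) = listDegree F v) :
    (hasRoom x).eval inp m.toMem ≠ 0 ↔
      listDegree F v < degreeCap (coveredVertices (M.take m.thr)) v := by
  have h1 : (StreamExpr.cell 1 (degAddr x)).eval inp m.toMem = listDegree F v := by
    rw [← hdeg, ← hx, ← hn]
    rfl
  have h2 : (StreamExpr.sub (.const 8) (.mul (.const 6) (covered x))).eval inp m.toMem =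
      degreeCap (coveredVertices (M.take m.thr)) v := by
    rw [StreamExpr.eval, StreamExpr.eval, StreamExpr.eval, StreamExpr.eval,
      eval_covered hord hx, degreeCap]
    split_ifs <;> rfl
  rw [hasRoom, eval_lt_ne_zero, h1, h2]

theorem eval_keepTest {M F : List (Fin n × Fin n)} (hord : OrdSpec m.ord M)
    (hcnt : m.cnt = M.length) (hdeg : ∀ v : Fin n, m.deg (m.idx * n + v) = listDegree F v)
    (e : Fin n × Fin n) :
    keepTest.eval ⟨n, e.1, e.2⟩ m.toMem ≠ 0 ↔ m.thr ≤ M.length ∧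
      ¬(e.1 ∈ coveredVertices (M.take m.thr) ↔ e.2 ∈ coveredVertices (M.take m.thr)) ∧
      listDegree F e.1 < degreeCap (coveredVertices (M.take m.thr)) e.1 ∧
      listDegree F e.2 < degreeCap (coveredVertices (M.take m.thr)) e.2 := by
  rw [keepTest, eval_mul_ne_zero, eval_mul_ne_zero, eval_mul_ne_zero,
    eval_hasRoom hord rfl (v := e.1) rfl (hdeg _), eval_hasRoom hord rfl (v := e.2) rfl (hdeg _),
    eval_lt_ne_zero, eval_eq_ne_zero]
  refine and_congr ?_ (and_congr ?_ Iff.rfl)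
  · rw [← hcnt]
    exact Nat.lt_succ_iff
  · rw [StreamExpr.eval, StreamExpr.eval,
      eval_covered (inp := ⟨n, e.1, e.2⟩) hord (x := .fst) (v := e.1) rfl,
      eval_covered (inp := ⟨n, e.1, e.2⟩) hord (x := .snd) (v := e.2) rfl]
    split_ifs <;> simp_all

/-- The degree tables of the thresholds are consecutive blocks of length `n` in one array; this
shows that they do not overlap. -/
theorem mul_add_fin_inj {i j : ℕ} {u v : Fin n} (h : i * n + (u : ℕ) = j * n + v) :
    i = j ∧ u = v := by
  have hn : 0 < n := u.pos
  have h1 : (i * n + (u : ℕ)) / n = i := by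
    rw [mul_comm, Nat.mul_add_div hn, Nat.div_eq_of_lt u.2, add_zero]
  have h2 : (j * n + (v : ℕ)) / n = j := by
    rw [mul_comm, Nat.mul_add_div hn, Nat.div_eq_of_lt v.2, add_zero]
  have hij : i = j := by rw [← h1, h, h2]
  subst hij
  exact ⟨rfl, Fin.ext (by omega)⟩

/-- The list `a` is what is added: empty or `[e]`. The sets `F` are not stored separately; the
program only knows their degrees, and puts the edges kept for all thresholds into the common list
`H`. -/
theorem runs_keep {M F H : List (Fin n × Fin n)} {e : Fin n × Fin n} (he : e.1 ≠ e.2)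
    (hord : OrdSpec m.ord M) (hcnt : m.cnt = M.length)
    (hdeg : ∀ v : Fin n, m.deg (m.idx * n + v) = listDegree F v)
    (hlen : m.len = H.length) (hH : Stores m.left m.right H) (hS : H.length < S)
    (hSi : m.idx * n + n ≤ S) (hW : H.length + 1 < 2 ^ W) (hn : n + 8 < 2 ^ W)
    (h : ∀ a d l r, (∀ p ∈ a, p = e) → runStep m.thr M F e = F ++ a →
      (∀ v : Fin n, d (m.idx * n + v) = listDegree (F ++ a) v) →
      (∀ x, (∀ v : Fin n, x ≠ m.idx * n + v) → d x = m.deg x) → Stores l r (H ++ a) →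
      Q { m with deg := d, left := l, right := r, len := (H ++ a).length } o) :
    Runs ⟨n, e.1, e.2⟩ S W keep m o Q := by
  have hcap : ∀ U : Finset (Fin n), ∀ v, degreeCap U v ≤ 8 := by
    intro U v
    unfold degreeCap
    split_ifs <;> omega
  refine Runs.ite (fun hb => ?_) fun hb => Runs.skip ?_
  · rw [eval_keepTest hord hcnt hdeg] at hb
    have hc1 := hcap (coveredVertices (M.take m.thr)) e.1
    have hc2 := hcap (coveredVertices (M.take m.thr)) e.2
    have hd1 := hdeg e.1
    have hd2 := hdeg e.2
    -- Since `e` is not a loop, the two degree counters are different cells and the second update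
    -- does not see the first.
    have hne : m.idx * n + (e.2 : ℕ) ≠ m.idx * n + e.1 := fun h =>
      he (mul_add_fin_inj h).2.symm
    refine Runs.seq (Runs.write (p := m.idx * n + e.1) (v := listDegree F e.1 + 1) rfl
      (by rw [← hd1]; rfl) (by omega) (by omega) (MatchMem.update_deg _ _ _) ?_)
    refine Runs.seq (Runs.write (p := m.idx * n + e.2) (v := listDegree F e.2 + 1) rfl
      ?_ (by omega) (by omega) (MatchMem.update_deg _ _ _) ?_)
    · rw [← hd2, ← Function.update_of_ne hne (listDegree F e.1 + 1) m.deg]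
      rfl
    refine runs_append (by exact hlen) (by exact hH) hS hW (by omega) fun l r hlr => ?_
    refine h [e] _ l r (by simp) ?_ ?_ ?_ hlr
    · rw [runStep, if_pos hb]
    · intro v
      show Function.update (Function.update m.deg (m.idx * n + e.1) (listDegree F e.1 + 1))
        (m.idx * n + e.2) (listDegree F e.2 + 1) (m.idx * n + v) = _
      rw [listDegree_snoc]
      by_cases hv2 : v = e.2
      · subst hv2; simp
      · rw [Function.update_of_ne fun h => hv2 (mul_add_fin_inj h).2]
        by_cases hv1 : v = e.1
        · subst hv1; simp
        · rw [Function.update_of_ne fun h => hv1 (mul_add_fin_inj h).2, hdeg]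
          simp [Ne.symm hv1, Ne.symm hv2]
    · intro x hx
      show Function.update (Function.update m.deg (m.idx * n + e.1) (listDegree F e.1 + 1))
        (m.idx * n + e.2) (listDegree F e.2 + 1) x = _
      rw [Function.update_of_ne (hx _), Function.update_of_ne (hx _)]
  · have hb' := not_iff_not.2 (eval_keepTest hord hcnt hdeg e) |>.1 (not_not.2 hb)
    have := h [] m.deg m.left m.right (by simp) (by rw [runStep, if_neg hb']; simp)
      (by simpa using hdeg) (fun _ _ => rfl) (by simpa using hH)
    rw [List.append_nil, ← hlen] at this
    exact this

/-- The memory after the stream `σ`: the stored edges are `H`. -/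
structure Tracks (σ H : List (Fin n × Fin n)) (m : MatchMem) : Prop where
  cnt : m.cnt = (greedy σ).length
  ord : OrdSpec m.ord (greedy σ)
  deg : ∀ i < numThresholds n, ∀ v : Fin n,
    m.deg (i * n + v) = listDegree (run (threshold i) σ) v
  len : m.len = H.length
  stores : Stores m.left m.right H
  greedy_mem : ∀ p ∈ greedy σ, p ∈ H
  run_mem : ∀ i < numThresholds n, ∀ p ∈ run (threshold i) σ, p ∈ H
  mem_stream : ∀ p ∈ H, p ∈ σ
  length : H.length = (greedy σ).length +
    ∑ i ∈ Finset.range (numThresholds n), (run (threshold i) σ).length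
  sel : ∀ j, m.sel j = 0
  best : ∀ j, m.best j = 0
  halt : m.halt = 0
  top : m.top = 0

/-- The number of cells that the program uses in each array. -/
def numCells (n : ℕ) : ℕ := 2 * n * (numThresholds n + 1) + 1

/-- The number of bits of a cell. -/
def cellSize (n : ℕ) : ℕ := Nat.log 2 (numCells n + 2 * n + 20) + 1

theorem lt_two_pow_cellSize (n : ℕ) : numCells n + 2 * n + 20 < 2 ^ cellSize n :=
  Nat.lt_pow_succ_log_self (by norm_num) _

theorem length_greedy_le {σ : List (Fin n × Fin n)} (hσ : ∀ e ∈ σ, e.1 ≠ e.2) :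
    (greedy σ).length ≤ n := by
  have h1 := card_coveredVertices_greedy hσ
  have h2 := Finset.card_le_univ (coveredVertices (greedy σ))
  rw [Fintype.card_fin] at h2
  omega

theorem length_run_le_two_mul (τ : ℕ) (σ : List (Fin n × Fin n)) :
    (run τ σ).length ≤ 2 * n := by
  have h1 := length_run_le τ σ
  have h2 := Finset.card_le_univ (coveredVertices ((greedy σ).take τ))
  rw [Fintype.card_fin] at h2
  omega

/-- The streams may depend on the threshold because, in the middle of `keepAll`, only some of the
thresholds have seen the current edge. -/
theorem sum_length_run_le (ρ : ℕ → List (Fin n × Fin n)) :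
    ∑ i ∈ Finset.range (numThresholds n), (run (threshold i) (ρ i)).length ≤
      2 * n * numThresholds n := by
  refine (Finset.sum_le_card_nsmul _ _ (2 * n) fun i _ => length_run_le_two_mul _ _).trans ?_
  rw [Finset.card_range, smul_eq_mul, mul_comm]

theorem runs_keepAll {σ H : List (Fin n × Fin n)} {e : Fin n × Fin n} (hm : Tracks σ H m)
    (hl : ∀ e ∈ σ, e.1 ≠ e.2) (he : e.1 ≠ e.2)
    (h : ∀ i t d l r H', (∀ i < numThresholds n, ∀ v : Fin n,
        d (i * n + v) = listDegree (run (threshold i) (σ ++ [e])) v) →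
      Stores l r H' → (∀ p ∈ greedy σ, p ∈ H') →
      (∀ i < numThresholds n, ∀ p ∈ run (threshold i) (σ ++ [e]), p ∈ H') →
      (∀ p ∈ H', p ∈ σ ++ [e]) →
      H'.length = (greedy σ).length +
        ∑ i ∈ Finset.range (numThresholds n), (run (threshold i) (σ ++ [e])).length →
      Q { m with idx := i, thr := t, deg := d, left := l, right := r, len := H'.length } o) :
    Runs ⟨n, e.1, e.2⟩ (numCells n) (cellSize n) keepAll m o Q := by
  set J := numThresholds n with hJ
  have hW := lt_two_pow_cellSize n
  have hS : numCells n = 2 * n * J + 2 * n + 1 := by rw [numCells, ← hJ]; ring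
  have hJn : J ≤ n + 1 := numThresholds_le n
  have hg := length_greedy_le hl
  refine Runs.seq (Runs.write (p := 0) (v := 0) rfl rfl (by omega) (by omega) (MatchMem.update_idx _ 0) ?_)
  refine Runs.seq (Runs.write (p := 0) (v := 0) rfl rfl (by omega) (by omega) (MatchMem.update_thr _ 0) ?_)
  -- Invariant: the thresholds with index below `i` have processed `e`, the others have not.
  refine Runs.loop (fun m' o' => o' = o ∧ ∃ i d l r H', m' = { m with
      idx := i, thr := threshold i, deg := d, left := l, right := r, len := H'.length } ∧ i ≤ J ∧
    (∀ k < J, ∀ v : Fin n, d (k * n + v) =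
      listDegree (run (threshold k) (if k < i then σ ++ [e] else σ)) v) ∧
    Stores l r H' ∧ (∀ p ∈ greedy σ, p ∈ H') ∧
    (∀ k < J, ∀ p ∈ run (threshold k) (if k < i then σ ++ [e] else σ), p ∈ H') ∧
    (∀ p ∈ H', p ∈ σ ++ [e]) ∧
    H'.length = (greedy σ).length + ∑ k ∈ Finset.range J,
      (run (threshold k) (if k < i then σ ++ [e] else σ)).length)
    (fun m' => J - m'.idx) ⟨rfl, 0, m.deg, m.left, m.right, H, ?_⟩ ?_ ?_
  · refine ⟨by rw [← hm.len]; rfl, by omega, ?_, hm.stores, hm.greedy_mem, ?_, ?_, ?_⟩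
    · simpa using hm.deg
    · simpa using hm.run_mem
    · intro p hp
      exact List.mem_append_left _ (hm.mem_stream p hp)
    · simpa using hm.length
  · rintro m' o' ⟨rfl, i, d, l, r, H', rfl, hi, hd, hst, hgH, hrH, hHσ, hlen⟩ hb
    have hb : threshold i < n + 1 := eval_lt_ne_zero.1 hb
    have hiJ : i < J := threshold_le_iff.1 (by omega)
    have hsum := sum_length_run_le (n := n) fun k => if k < i then σ ++ [e] else σ
    rw [← hJ] at hsum
    have hmul : i * n + n ≤ n * J := by
      have : (i + 1) * n ≤ J * n := Nat.mul_le_mul_right n hiJ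
      rw [mul_comm n J, ← Nat.succ_mul]
      exact this
    have hmul2 : n * J ≤ 2 * n * J := Nat.mul_le_mul_right J (by omega)
    have hrun : run (threshold i) (if i < i then σ ++ [e] else σ) = run (threshold i) σ := by
      simp
    refine Runs.seq (runs_keep (M := greedy σ) (F := run (threshold i) σ) (H := H') he
      (by exact hm.ord) (by exact hm.cnt) (fun v => by rw [← hrun]; exact hd i hiJ v) rfl
      (by exact hst) (by omega) (show i * n + n ≤ _ by omega) (by omega) (by omega) ?_)
    intro a d' l' r' ha hstep hd' hd'' hst'
    have hstep : run (threshold i) (σ ++ [e]) = run (threshold i) σ ++ a := by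
      rw [run_snoc]; exact hstep
    refine Runs.seq (Runs.write (p := 0) (v := threshold (i + 1)) rfl rfl (by omega) ?_
      (MatchMem.update_thr _ _) ?_)
    -- The cell `thr` also has to hold the first threshold above `n`, which is at most `n + n / 100
    -- + 1`.
    · rw [threshold]; omega
    refine Runs.write (p := 0) (v := i + 1) rfl rfl (by omega) (by omega) (MatchMem.update_idx _ _)
      ⟨⟨rfl, i + 1, d', l', r', H' ++ a, rfl, hiJ, ?_, hst', ?_, ?_, ?_, ?_⟩, ?_⟩
    · intro k hk v
      by_cases hki : k = i
      · subst hki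
        rw [if_pos (Nat.lt_succ_self _), hstep]
        exact hd' v
      · have hlt : k < i + 1 ↔ k < i := by omega
        simp only [hlt]
        rw [← hd k hk v]
        exact hd'' _ fun u hu => hki (mul_add_fin_inj hu).1
    · exact fun p hp => List.mem_append_left _ (hgH p hp)
    · intro k hk p hp
      by_cases hki : k = i
      · subst hki
        rw [if_pos (Nat.lt_succ_self _), hstep] at hp
        rcases List.mem_append.1 hp with hp | hp
        · exact List.mem_append_left _ (hrH k hk p (by rwa [hrun]))
        · exact List.mem_append_right _ hp
      · have hlt : k < i + 1 ↔ k < i := by omega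
        simp only [hlt] at hp
        exact List.mem_append_left _ (hrH k hk p hp)
    · intro p hp
      rcases List.mem_append.1 hp with hp | hp
      · exact hHσ p hp
      · exact List.mem_append_right _ (List.mem_singleton.2 (ha p hp))
    · rw [List.length_append, hlen, ← Finset.add_sum_erase _ _ (Finset.mem_range.2 hiJ),
        ← Finset.add_sum_erase _ _ (Finset.mem_range.2 hiJ), hrun, if_pos (Nat.lt_succ_self i),
        hstep, List.length_append]
      have : ∑ k ∈ (Finset.range J).erase i,
          (run (threshold k) (if k < i + 1 then σ ++ [e] else σ)).length =
          ∑ k ∈ (Finset.range J).erase i,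
          (run (threshold k) (if k < i then σ ++ [e] else σ)).length := by
        refine Finset.sum_congr rfl fun k hk => ?_
        have hlt : k < i + 1 ↔ k < i := by
          have := Finset.ne_of_mem_erase hk
          omega
        simp only [hlt]
      rw [this]
      omega
    · show J - (i + 1) < J - i
      omega
  · rintro m' o' ⟨rfl, i, d, l, r, H', rfl, hi, hd, hst, hgH, hrH, hHσ, hlen⟩ hb
    have hb : n + 1 ≤ threshold i := eval_lt_eq_zero.1 hb
    have hiJ : i = J := by
      by_contra hc
      have := threshold_le_iff.2 (lt_of_le_of_ne hi hc)
      omega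
    subst hiJ
    refine h _ _ d l r H' ?_ hst hgH ?_ hHσ ?_
    · intro k hk v
      rw [hd k hk v, if_pos hk]
    · intro k hk p hp
      exact hrH k hk p (by rwa [if_pos hk])
    · rw [hlen]
      congr 1
      refine Finset.sum_congr rfl fun k hk => ?_
      rw [if_pos (Finset.mem_range.1 hk)]

/-- The order of the two halves of `process` matters: `runStep` refers to the greedy matching before
`e`, so all thresholds are treated before `e` is offered to greedy. -/
theorem runs_process {σ H : List (Fin n × Fin n)} {e : Fin n × Fin n} (hm : Tracks σ H m)
    (hl : ∀ e ∈ σ, e.1 ≠ e.2) (he : e.1 ≠ e.2) :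
    Runs ⟨n, e.1, e.2⟩ (numCells n) (cellSize n) process m o fun m' o' =>
      o' = o ∧ ∃ H', Tracks (σ ++ [e]) H' m' := by
  have hW := lt_two_pow_cellSize n
  have hS : numCells n = 2 * n * numThresholds n + 2 * n + 1 := by rw [numCells]; ring
  have hg := length_greedy_le hl
  have h1 := e.1.2
  have h2 := e.2.2
  refine Runs.seq (runs_keepAll hm hl he ?_)
  intro i t d l r H' hd hst hgH hrH hHσ hlen
  have hsum := sum_length_run_le (n := n) fun _ => σ ++ [e]
  have hc := hm.ord.pos_iff
  have hiff : (StreamExpr.add (.cell 0 .fst) (.cell 0 .snd)).eval ⟨n, e.1, e.2⟩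
      (MatchMem.toMem { m with
        idx := i, thr := t, deg := d, left := l, right := r, len := H'.length }) ≠ 0 ↔
      e.1 ∈ coveredVertices (greedy σ) ∨ e.2 ∈ coveredVertices (greedy σ) := by
    rw [eval_add_ne_zero, ← hc, ← hc, Nat.pos_iff_ne_zero, Nat.pos_iff_ne_zero]
    rfl
  refine Runs.ite (fun hb => Runs.skip ?_) fun hb => ?_
  · rw [hiff] at hb
    have hgr : greedy (σ ++ [e]) = greedy σ := by rw [greedy_snoc, greedyStep, if_pos hb]
    exact ⟨rfl, H', by rw [hgr]; exact hm.cnt, by rw [hgr]; exact hm.ord, hd, rfl, hst,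
      by rwa [hgr], hrH, hHσ, by rwa [hgr], hm.sel, hm.best, hm.halt, hm.top⟩
  · have hb := not_iff_not.2 hiff |>.1 (not_not.2 hb)
    have hgr : greedy (σ ++ [e]) = greedy σ ++ [e] := by rw [greedy_snoc, greedyStep, if_neg hb]
    push Not at hb
    have hcnt := hm.cnt
    refine Runs.seq (Runs.write (p := 0) (v := (greedy σ).length + 1) rfl (by rw [← hcnt]; rfl) (by omega)
      (by omega) (MatchMem.update_cnt _ _) ?_)
    refine Runs.seq (Runs.write (p := e.1) (v := (greedy σ).length + 1) rfl rfl (by omega)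
      (by omega) (MatchMem.update_ord _ _ _) ?_)
    refine Runs.seq (Runs.write (p := e.2) (v := (greedy σ).length + 1) rfl rfl (by omega)
      (by omega) (MatchMem.update_ord _ _ _) ?_)
    refine runs_append (H := H') rfl (by exact hst) (by omega) (by omega) (by omega)
      fun l' r' hst' => ⟨rfl, H' ++ [e], ?_⟩
    refine ⟨?_, ?_, hd, rfl, hst', ?_, ?_, ?_, ?_, hm.sel, hm.best, hm.halt, hm.top⟩
    · show (greedy σ).length + 1 = _
      simp [hgr]
    · rw [hgr]; exact hm.ord.snoc hb.1 hb.2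
    · rw [hgr]
      intro p hp
      rcases List.mem_append.1 hp with hp | hp
      · exact List.mem_append_left _ (hgH p hp)
      · exact List.mem_append_right _ hp
    · exact fun i hi p hp => List.mem_append_left _ (hrH i hi p hp)
    · intro p hp
      rcases List.mem_append.1 hp with hp | hp
      · exact hHσ p hp
      · exact List.mem_append_right _ hp
    · rw [hgr, List.length_append, hlen, List.length_append]
      omega

end MatchProgram

/-- The matching program. -/
def matchProgram : StreamProgram where
  k := 16
  init := .skip
  step := MatchProgram.process
  final := .seq MatchProgram.search MatchProgram.output

/-! ### Correctness of the program on a whole stream -/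

namespace MatchProgram

variable {n : ℕ}

theorem exists_streamPass {σ ρ H : List (Fin n × Fin n)} {m : MatchMem} (hm : Tracks σ H m)
    (hl : ∀ e ∈ σ ++ ρ, e.1 ≠ e.2) :
    ∃ m' H', StreamPass (numCells n) (cellSize n) process ρ ⟨m.toMem, []⟩ ⟨m'.toMem, []⟩ ∧
      Tracks (σ ++ ρ) H' m' := by
  induction ρ generalizing σ H m with
  | nil => exact ⟨m, H, rfl, by simpa using hm⟩
  | cons e ρ ih =>
    obtain ⟨m₁, o₁, h₁, rfl, H₁, hm₁⟩ := runs_process (o := []) hm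
      (fun e he => hl e (by simp [he])) (hl e (by simp))
    have hassoc : σ ++ [e] ++ ρ = σ ++ e :: ρ := by simp
    obtain ⟨m', H', h', hm'⟩ := ih hm₁ (by rwa [hassoc])
    rw [hassoc] at hm'
    exact ⟨m', H', ⟨_, h₁, h'⟩, hm'⟩

theorem tracks_zero : Tracks ([] : List (Fin n × Fin n)) [] MatchMem.zero where
  cnt := rfl
  ord v τ := by simp [MatchMem.zero, greedy, coveredVertices]
  deg i _ v := by simp [MatchMem.zero, run, listDegree]
  len := rfl
  stores j hj := by simp at hj
  greedy_mem := by simp [greedy]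
  run_mem := by simp [run]
  mem_stream := by simp
  length := by simp [greedy, run]
  sel _ := rfl
  best _ := rfl
  halt := rfl
  top := rfl

theorem conflict_iff {m : MatchMem} {H : List (Fin n × Fin n)} (hH : Stores m.left m.right H)
    {i j : ℕ} (hi : i < H.length) (hj : j < H.length) :
    Conflict m i j ↔ ∃ v, v ∈ s(H[i].1, H[i].2) ∧ v ∈ s(H[j].1, H[j].2) := by
  rw [Conflict, (hH i hi).1, (hH i hi).2, (hH j hj).1, (hH j hj).2]
  simp only [Fin.val_inj, Sym2.mem_iff]
  constructor
  · rintro (h | h | h | h)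
    · exact ⟨_, Or.inl rfl, Or.inl h⟩
    · exact ⟨_, Or.inl rfl, Or.inr h⟩
    · exact ⟨_, Or.inr rfl, Or.inl h⟩
    · exact ⟨_, Or.inr rfl, Or.inr h⟩
  · rintro ⟨v, rfl | rfl, h | h⟩
    · exact Or.inl h
    · exact Or.inr (Or.inl h)
    · exact Or.inr (Or.inr (Or.inl h))
    · exact Or.inr (Or.inr (Or.inr h))

/-- The edges of `H` at the positions marked by `b`. -/
def markedEdges (H : List (Fin n × Fin n)) (b : ℕ → ℕ) : List (Fin n × Fin n) :=
  ((List.finRange H.length).filter fun j : Fin H.length => b j ≠ 0).map H.get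

theorem map_markedEdges {left right : ℕ → ℕ} {H : List (Fin n × Fin n)}
    (hH : Stores left right H) (b : ℕ → ℕ) :
    (markedEdges H b).map (fun e => ((e.1 : ℕ), (e.2 : ℕ))) =
      ((List.range H.length).filter fun j => b j ≠ 0).map fun j => (left j, right j) := by
  rw [markedEdges, ← List.map_coe_finRange_eq_range, List.filter_map, List.map_map, List.map_map]
  refine List.map_congr_left fun j _ => ?_
  have := hH j j.2
  simp [this.1, this.2]

theorem mem_edgeSetOf {l : List (Fin n × Fin n)} {e : Sym2 (Fin n)} :
    e ∈ edgeSetOf l ↔ ∃ p ∈ l, s(p.1, p.2) = e := by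
  simp [edgeSetOf]

theorem mem_edgeSetOf_markedEdges {H : List (Fin n × Fin n)} {b : ℕ → ℕ} {e : Sym2 (Fin n)} :
    e ∈ edgeSetOf (markedEdges H b) ↔
      ∃ (j : ℕ) (hj : j < H.length), b j ≠ 0 ∧ s(H[j].1, H[j].2) = e := by
  rw [mem_edgeSetOf]
  simp only [markedEdges, List.mem_map, List.mem_filter, List.mem_finRange, true_and,
    decide_eq_true_eq]
  constructor
  · rintro ⟨p, ⟨j, hj, rfl⟩, h⟩
    exact ⟨j, j.2, hj, h⟩
  · rintro ⟨j, hj, hb, h⟩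
    exact ⟨_, ⟨⟨j, hj⟩, hb, rfl⟩, h⟩

theorem isMatching_markedEdges {m : MatchMem} {H : List (Fin n × Fin n)}
    (hH : Stores m.left m.right H) {b : ℕ → ℕ} (hb : Valid m (marked H.length b)) :
    IsMatching (edgeSetOf (markedEdges H b)) := by
  rw [isMatching_iff]
  intro e he e' he' v hv hv'
  obtain ⟨i, hi, hbi, rfl⟩ := mem_edgeSetOf_markedEdges.1 he
  obtain ⟨j, hj, hbj, rfl⟩ := mem_edgeSetOf_markedEdges.1 he'
  rcases lt_trichotomy i j with h | h | h
  · exact (hb i (mem_marked.2 ⟨hi, hbi⟩) j (mem_marked.2 ⟨hj, hbj⟩) h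
      ((conflict_iff hH hi hj).2 ⟨v, hv, hv'⟩)).elim
  · subst h; rfl
  · exact (hb j (mem_marked.2 ⟨hj, hbj⟩) i (mem_marked.2 ⟨hi, hbi⟩) h
      ((conflict_iff hH hj hi).2 ⟨v, hv', hv⟩)).elim

/-- An edge may be stored several times, by greedy and for several thresholds. Copies of an edge
conflict with each other, so a valid selection contains no edge twice and its size is not an
overcount. -/
theorem card_marked_le {m : MatchMem} {H : List (Fin n × Fin n)}
    (hH : Stores m.left m.right H) {b : ℕ → ℕ} (hb : Valid m (marked H.length b)) :
    (marked H.length b).card ≤ (edgeSetOf (markedEdges H b)).card := by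
  have h1 : edgeSetOf (markedEdges H b) = (Finset.univ.filter fun j : Fin H.length =>
      b j ≠ 0).image fun j => s(H[j].1, H[j].2) := by
    ext e
    rw [mem_edgeSetOf_markedEdges]
    simp only [Finset.mem_image, Finset.mem_filter, Finset.mem_univ, true_and]
    constructor
    · rintro ⟨j, hj, hbj, h⟩
      exact ⟨⟨j, hj⟩, hbj, h⟩
    · rintro ⟨j, hbj, h⟩
      exact ⟨j, j.2, hbj, h⟩
  have h2 : marked H.length b = (Finset.univ.filter fun j : Fin H.length =>
      b j ≠ 0).image Fin.val := by
    ext j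
    rw [mem_marked]
    simp only [Finset.mem_image, Finset.mem_filter, Finset.mem_univ, true_and]
    constructor
    · rintro ⟨hj, hbj⟩
      exact ⟨⟨j, hj⟩, hbj, rfl⟩
    · rintro ⟨j, hbj, rfl⟩
      exact ⟨j.2, hbj⟩
  rw [h2, h1, Finset.card_image_of_injOn (s := Finset.univ.filter fun j : Fin H.length => b j ≠ 0)
    (f := fun j => s(H[j].1, H[j].2))]
  · exact Finset.card_image_le
  · intro i hi j hj h
    have hi' := mem_marked.2 ⟨i.2, (Finset.mem_filter.1 hi).2⟩
    have hj' := mem_marked.2 ⟨j.2, (Finset.mem_filter.1 hj).2⟩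
    have h : s(H[(i : ℕ)].1, H[(i : ℕ)].2) = s(H[(j : ℕ)].1, H[(j : ℕ)].2) := h
    by_contra hne
    rcases lt_or_gt_of_ne fun hv => hne (Fin.ext hv) with hlt | hlt
    · exact hb i hi' j hj' hlt ((conflict_iff hH i.2 j.2).2
        ⟨H[(i : ℕ)].1, by simp, by rw [← h]; simp⟩)
    · exact hb j hj' i hi' hlt ((conflict_iff hH j.2 i.2).2
        ⟨H[(i : ℕ)].1, by rw [← h]; simp, by simp⟩)

/-- Choosing one position in `H` for each edge of `N` gives a valid selection of the same size. -/
theorem card_le_of_stored {m : MatchMem} {H : List (Fin n × Fin n)}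
    (hH : Stores m.left m.right H) {c : ℕ}
    (hc : ∀ B ⊆ Finset.range H.length, Valid m B → B.card ≤ c) {N : Finset (Sym2 (Fin n))}
    (hN : IsMatching N) (hNH : ∀ e ∈ N, ∃ p ∈ H, e = s(p.1, p.2)) : N.card ≤ c := by
  have hex : ∀ e, ∃ j, e ∈ N → ∃ hj : j < H.length, s(H[j].1, H[j].2) = e := by
    intro e
    by_cases he : e ∈ N
    · obtain ⟨p, hp, rfl⟩ := hNH e he
      obtain ⟨j, hj, rfl⟩ := List.getElem_of_mem hp
      exact ⟨j, fun _ => ⟨hj, rfl⟩⟩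
    · exact ⟨0, fun h => (he h).elim⟩
  choose g hg using hex
  have hinj : Set.InjOn g N := by
    intro e he e' he' h
    obtain ⟨hj, h1⟩ := hg e he
    obtain ⟨hj', h2⟩ := hg e' he'
    rw [← h1, ← h2]
    simp only [h]
  rw [← Finset.card_image_of_injOn hinj]
  refine hc _ ?_ ?_
  · intro j hj
    obtain ⟨e, he, rfl⟩ := Finset.mem_image.1 hj
    exact Finset.mem_range.2 (hg e he).1
  · intro l hl j hj hlj hconf
    obtain ⟨e, he, rfl⟩ := Finset.mem_image.1 hl
    obtain ⟨e', he', rfl⟩ := Finset.mem_image.1 hj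
    obtain ⟨h1, h1'⟩ := hg e he
    obtain ⟨h2, h2'⟩ := hg e' he'
    obtain ⟨v, hv, hv'⟩ := (conflict_iff hH h1 h2).1 hconf
    rw [h1'] at hv
    rw [h2'] at hv'
    rw [isMatching_iff.1 hN e he e' he' v hv hv'] at hlj
    exact lt_irrefl _ hlj

/-- The program outputs a matching that is at least as large as every matching among the edges
that are kept. -/
theorem exists_outputs {σ : List (Fin n × Fin n)} (hσ : IsEdgeStream σ) :
    ∃ out, matchProgram.Outputs (numCells n) (cellSize n) σ out ∧
      edgeSetOf out ⊆ edgeSetOf σ ∧ IsMatching (edgeSetOf out) ∧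
      ∀ i < numThresholds n, ∀ N : Finset (Sym2 (Fin n)), IsMatching N →
        (∀ e ∈ N, ∃ p ∈ greedy σ ++ run (threshold i) σ, e = s(p.1, p.2)) →
          N.card ≤ (edgeSetOf out).card := by
  obtain ⟨m, H, hpass, hm⟩ := exists_streamPass (σ := []) (ρ := σ) tracks_zero hσ.1
  rw [List.nil_append] at hm
  have hlen := hm.len
  have hW := lt_two_pow_cellSize n
  have hS : m.len < numCells n := by
    have h1 := length_greedy_le hσ.1
    have h2 := sum_length_run_le (n := n) fun _ => σ
    have h3 : numCells n = 2 * n * numThresholds n + 2 * n + 1 := by rw [numCells]; ring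
    have h4 := hm.length
    omega
  obtain ⟨m', o', hfin, b, ho, hb, hmax⟩ : Runs ⟨n, 0, 0⟩ (numCells n) (cellSize n)
      (.seq search output) m [] fun _ o' => ∃ b, o' = (markedEdges H b).map
        (fun e => ((e.1 : ℕ), (e.2 : ℕ))) ∧ Valid m (marked m.len b) ∧
        ∀ B ⊆ Finset.range m.len, Valid m B → B.card ≤ (marked m.len b).card := by
    refine Runs.seq (runs_search hS (by omega) hm.halt hm.top hm.sel hm.best ?_)
    intro s b p a z k t h hb hmax
    refine runs_output (by exact hS) (show m.len + 1 < _ by omega) fun q => ⟨b, ?_, hb, hmax⟩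
    rw [map_markedEdges hm.stores, ← hlen, List.nil_append]
  rw [hlen] at hb hmax
  refine ⟨markedEdges H b, ⟨_, _, _, ?_, hpass, hfin, ho⟩, ?_, isMatching_markedEdges hm.stores hb,
    ?_⟩
  · rw [MatchMem.toMem_zero]
    exact .skip _
  · intro e he
    obtain ⟨j, hj, -, rfl⟩ := mem_edgeSetOf_markedEdges.1 he
    exact mem_edgeSetOf.2 ⟨H[j], hm.mem_stream _ (List.getElem_mem hj), rfl⟩
  · intro i hi N hN hNe
    refine (card_le_of_stored hm.stores hmax hN fun e he => ?_).trans (card_marked_le hm.stores hb)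
    obtain ⟨p, hp, h⟩ := hNe e he
    refine ⟨p, ?_, h⟩
    rcases List.mem_append.1 hp with hp | hp
    · exact hm.greedy_mem p hp
    · exact hm.run_mem i hi p hp

/-- The function computed by the matching program. -/
noncomputable def matchingOutput (n : ℕ) (σ : List (Fin n × Fin n)) : List (Fin n × Fin n) :=
  -- The default value is harmless: `SemiStreaming` and the guarantee only concern edge streams.
  open Classical in if hσ : IsEdgeStream σ then (exists_outputs hσ).choose else []

theorem matchingOutput_spec {σ : List (Fin n × Fin n)} (hσ : IsEdgeStream σ) :
    matchProgram.Outputs (numCells n) (cellSize n) σ (matchingOutput n σ) ∧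
      edgeSetOf (matchingOutput n σ) ⊆ edgeSetOf σ ∧ IsMatching (edgeSetOf (matchingOutput n σ)) ∧
      ∀ i < numThresholds n, ∀ N : Finset (Sym2 (Fin n)), IsMatching N →
        (∀ e ∈ N, ∃ p ∈ greedy σ ++ run (threshold i) σ, e = s(p.1, p.2)) →
          N.card ≤ (edgeSetOf (matchingOutput n σ)).card := by
  rw [matchingOutput, dif_pos hσ]
  exact (exists_outputs hσ).choose_spec

/-! ### The space bound -/

theorem numCells_le {n : ℕ} (hn : 2 ≤ n) : numCells n ≤ 405 * (n * Nat.log 2 n) := by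
  have hL : 1 ≤ Nat.log 2 n := Nat.log_pos (by norm_num) hn
  have h1 := numThresholds_le_log n
  have h2 : numThresholds n + 1 ≤ 202 * Nat.log 2 n := by omega
  have h3 := Nat.mul_le_mul_left (2 * n) h2
  have h4 : 1 ≤ n * Nat.log 2 n := Nat.mul_pos (by omega) hL
  have h5 : 2 * n * (202 * Nat.log 2 n) = 404 * (n * Nat.log 2 n) := by ring
  unfold numCells
  omega

theorem cellSize_le {n : ℕ} (hn : 2 ≤ n) : cellSize n ≤ 22 * Nat.log 2 n := by
  have hL : 1 ≤ Nat.log 2 n := Nat.log_pos (by norm_num) hn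
  have hLn : Nat.log 2 n ≤ n := Nat.log_le_self 2 n
  have h1 := numCells_le hn
  have h2 := Nat.mul_le_mul_left n hLn
  have h3 : 2 * n ≤ n * n := Nat.mul_le_mul_right n hn
  -- A crude polynomial bound is enough, as only its logarithm matters: it is at most `n ^ 11`, so a
  -- cell has at most `11 * (Nat.log 2 n + 1)` bits.
  have h4 : numCells n + 2 * n + 20 ≤ 2 ^ 9 * (n * n) := by omega
  have h5 : 2 ^ 9 * (n * n) ≤ n ^ 11 := by
    rw [show n ^ 11 = n ^ 9 * (n * n) by ring]
    exact Nat.mul_le_mul_right _ (Nat.pow_le_pow_left hn 9)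
  have h6 : n ^ 11 < 2 ^ (11 * (Nat.log 2 n + 1)) := by
    rw [mul_comm, pow_mul]
    exact Nat.pow_lt_pow_left (Nat.lt_pow_succ_log_self (by norm_num) n) (by norm_num)
  have h7 := Nat.log_lt_of_lt_pow (b := 2) (by omega)
    ((h4.trans h5).trans_lt h6)
  unfold cellSize
  omega

theorem natLog_le_two_mul_log {n : ℕ} (hn : 2 ≤ n) : (Nat.log 2 n : ℝ) ≤ 2 * Real.log n := by
  have h1 : ((2 : ℝ) ^ Nat.log 2 n) ≤ n := by
    exact_mod_cast Nat.pow_log_le_self 2 (by omega : n ≠ 0)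
  have h2 := Real.log_le_log (by positivity) h1
  rw [Real.log_pow] at h2
  -- Only `Real.log 2 ≥ 1 / 2` is needed.
  have h3 := Real.log_two_gt_d9
  have h4 : (0 : ℝ) ≤ Nat.log 2 n := Nat.cast_nonneg _
  nlinarith

theorem space_isBigO :
    (fun n : ℕ => (matchProgram.k * numCells n * cellSize n : ℝ)) =O[Filter.atTop]
      (fun n : ℕ => (n : ℝ) * Real.log n ^ 2) := by
  -- The constant is `16 * 405 * 22 * 2 ^ 2`: arrays, cells, bits, and the passage from `Nat.log 2
  -- n` to `2 * Real.log n`, squared.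
  refine Asymptotics.IsBigO.of_bound 570240 ?_
  filter_upwards [Filter.eventually_ge_atTop 2] with n hn
  have h1 : (numCells n : ℝ) ≤ 405 * (n * Nat.log 2 n) := by exact_mod_cast numCells_le hn
  have h2 : (cellSize n : ℝ) ≤ 22 * Nat.log 2 n := by exact_mod_cast cellSize_le hn
  have h3 := natLog_le_two_mul_log hn
  have h4 : (0 : ℝ) ≤ Nat.log 2 n := Nat.cast_nonneg _
  have hk : ((matchProgram.k : ℕ) : ℝ) = 16 := by norm_num [matchProgram]
  rw [Real.norm_of_nonneg (by positivity), Real.norm_of_nonneg (by positivity), hk]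
  calc (16 : ℝ) * numCells n * cellSize n
      ≤ 16 * (405 * (n * Nat.log 2 n)) * (22 * Nat.log 2 n) := by gcongr
    _ = 142560 * (n * (Nat.log 2 n : ℝ) ^ 2) := by ring
    _ ≤ 142560 * (n * (2 * Real.log n) ^ 2) := by gcongr
    _ = 570240 * (n * Real.log n ^ 2) := by ring

end MatchProgram

/-! ### The approximation guarantee -/

theorem InjectionInstance.two_mul_matchingNumber_le {n : ℕ} (I : InjectionInstance n) :
    2 * matchingNumber I.goodEdges ≤ n := by
  obtain ⟨A, hA, hAc⟩ := I.exists_maximum_matching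
  have h1 := card_pairsMeeting_add_card_pairsInside hA (by
    intro e he
    obtain ⟨i, -, rfl⟩ := Finset.mem_image.1 he
    exact I.loopless _) Finset.univ
  simp only [pairsMeeting, pairsInside, Finset.mem_univ, true_or, true_and,
    Finset.filter_true] at h1
  rw [Finset.card_image_of_injective _ I.goodEdge_injective, hAc] at h1
  have h2 := Finset.card_le_univ (Finset.univ ∩ endpoints (A.image I.goodEdge))
  rw [Fintype.card_fin] at h2
  omega

theorem InjectionInstance.edgeSetOf_stream_subset {n : ℕ} (I : InjectionInstance n)
    (π : Equiv.Perm {i // i ∈ I.good}) : edgeSetOf (I.stream π) ⊆ I.edges := by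
  intro e he
  obtain ⟨p, hp, rfl⟩ := MatchProgram.mem_edgeSetOf.1 he
  rw [InjectionInstance.stream, List.mem_ofFn] at hp
  obtain ⟨i, rfl⟩ := hp
  exact Finset.mem_image.2 ⟨_, Finset.mem_univ _, rfl⟩

theorem theorem1 :
    ∃ γ : ℝ, 0 < γ ∧
      ∃ (P : StreamProgram) (f : (n : ℕ) → List (Fin n × Fin n) → List (Fin n × Fin n)),
        P.SemiStreaming f ∧
        ∀ (n : ℕ) (I : InjectionInstance n),
          (∀ π : Equiv.Perm {i // i ∈ I.good},
            edgeSetOf (f n (I.stream π)) ⊆ I.edges ∧ IsMatching (edgeSetOf (f n (I.stream π)))) ∧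
          (1 / 2 + γ) * (matchingNumber I.goodEdges : ℝ) ≤
            Finset.expect Finset.univ (fun π : Equiv.Perm {i // i ∈ I.good} =>
              ((edgeSetOf (f n (I.stream π))).card : ℝ)) := by
  refine ⟨1 / 2600, by norm_num, matchProgram, MatchProgram.matchingOutput,
    ⟨MatchProgram.numCells, MatchProgram.cellSize, 2, MatchProgram.space_isBigO,
      fun n σ hσ => (MatchProgram.matchingOutput_spec hσ).1⟩, fun n I => ?_⟩
  have hstream : ∀ π, IsEdgeStream (I.stream π) := fun π =>
    ⟨I.stream_loopless π, I.stream_nodup π⟩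
  refine ⟨fun π => ⟨?_, (MatchProgram.matchingOutput_spec (hstream π)).2.2.1⟩, ?_⟩
  · exact (MatchProgram.matchingOutput_spec (hstream π)).2.1.trans (I.edgeSetOf_stream_subset π)
  obtain ⟨A, hA, hAc⟩ := I.exists_maximum_matching
  have hn := I.two_mul_matchingNumber_le
  rw [← hAc] at hn ⊢
  rcases Nat.eq_zero_or_pos A.card with h0 | h0
  · rw [h0, Nat.cast_zero, mul_zero]
    exact Finset.expect_nonneg fun _ _ => Nat.cast_nonneg _
  obtain ⟨i, hi, hi'⟩ := MatchProgram.exists_threshold A.card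
  -- The analysis picks a threshold that depends on the unknown size of `A`. As `2 * A.card ≤ n` and
  -- `A` is nonempty, it is at most `n`, hence among those that the program handles.
  have hiJ : i < MatchProgram.numThresholds n :=
    MatchProgram.threshold_le_iff.1 (by omega)
  exact I.expect_bound hA hi hi' h0 _ fun π =>
    (MatchProgram.matchingOutput_spec (hstream π)).2.2.2 i hiJ
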